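/- Let $K$ be a field of characteristic zero, $\partial=\frac{d}{dx}$ and $H=\partial x$, viewed as operators on $K[x]$; $H$ is invertible, since $Hx^k=(k+1)x^k$. The Jacobian algebra $\mathbb{A}_1$ is the subalgebra of $\mathrm{End}_K(K[x])$ generated by $x$, $\partial$ and $H^{-1}$. Let ${}'\mathcal{C}_{\mathbb{A}_1}$ (resp. $\mathcal{C}'_{\mathbb{A}_1}$) be the set of left (resp. right) regular elements of $\mathbb{A}_1$, i.e. those $a\in\mathbb{A}_1$ for which the map $\mathbb A_1\to\mathbb A_1$, $b\mapsto ba$ (resp. $b\mapsto ab$) is injective. Let $\theta$ be the involution (anti-automorphism of order two) of $\mathbb{A}_1$ with $\theta(x)=\partial$, $\theta(\partial)=x$, $\theta(H^{-1})=H^{-1}$. Let $P_1'=K[\partial]$ be the right $\mathbb{A}_1$-module obtained from the left module $K[x]$ by $p\cdot a:=\theta(a)p$ (with $x^k$ rewritten as $\partial^k$; thus $\partial^k\cdot\partial=\partial^{k+1}$, $\partial^k\cdot x=k\partial^{k-1}$), and let $P'_{1,\le i}$ be the space of $p\in P_1'$ of degree at most $i$ in $\partial$. Let $F=\bigoplus_{i,j\ge0}KE_{ij}$,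 where $E_{ij}x^k=\delta_{jk}x^i$; this is an ideal of $\mathbb{A}_1$. Put $L=K[H^{\pm1},(H+1)^{-1},(H+2)^{-1},\dots]$, $L^\perp=\bigoplus_{i,j\ge1}Kx^iH^{-j}\partial^i$, $\mathbb{D}_1=L\oplus L^\perp$ and $$\Xi=\Big(\bigoplus_{i\ge0}L^\perp\partial^i\oplus\bigoplus_{i\ge1}x^i\mathbb{D}_1\Big)\cup\Big(\bigoplus_{i\ge1}x^i\mathbb{D}_1+F\Big).$$ For $f\in F$ let $s(f)=\min\{n\in\mathbb N: f\in\bigoplus_{i,j=0}^nKE_{ij}\}$ if $f\ne0$, and $s(0)=-1$. For $l^\perp=\sum_{i,j\ge1}\lambda_{ij}x^iH^{-j}\partial^i\in L^\perp$ let $$\phi(l^\perp)=\sum_{i,j\ge1}\lambda_{ij}\frac{(H-i)(H-i+1)\cdots(H-1)}{(H-i)^j}\in K(H),$$ let $\delta(l^\perp)$ be the largest $i$ with $\lambda_{ij}\ne0$ for some $j$, and $\delta(0)=0$. With $\tau(H)=H+1$, for $d=l+l^\perp\in\mathbb{D}_1\setminus F$ ($l\in L$, $l^\perp\in L^\perp$)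 let $$\mu(d)=\min\{i\ge\delta(l^\perp): \text{the rational function }\tau^i(l+\phi(l^\perp))\text{ has no root in }\{1,2,\dots\}\}.$$ A decomposition of $a\in\mathbb{A}_1$ is an expression $a=\sum_{i\ge0}d_{-i}\partial^i+\sum_{j\ge1}x^jd_j+a_F$ (finite sums) with all $d_k\in\mathbb{D}_1$ and $a_F\in F$; put $a_\partial=\sum_{i\ge 0}d_{-i}\partial^i$ and let $n=\deg_\partial(a_\partial)$ be the largest $i$ with $d_{-i}\ne0$. The decomposition is called reduced if $a_\partial\neq 0$ and $d_{-n}\notin F$, and then $\nu(a):=\max\{s(a_F),\mu(d_{-n})\}$. Theorem. (0) Every $a\in\mathbb{A}_1\setminus\Xi$ has a reduced decomposition, and $\mu(d)$ is defined (the minimum is over a nonempty set) for every $d\in\mathbb{D}_1\setminus F$. For each $a\in\mathbb{A}_1\setminus\Xi$ and each reduced decomposition of $a$, $P'_{1,\le\nu(a)}\cdot a\subseteq P'_{1,\le\nu(a)+\deg_\partial(a_\partial)}$. (1) Whichever reduced decompositions of the elements $a\in\mathbb{A}_1\setminus\Xi$ are used to compute $\nu(a)$ and $a_\partial$, $${}'\mathcal{C}_{\mathbb{A}_1}=\{a\in\mathbb{A}_1\setminus\Xi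 : \text{the map } P'_{1,\le\nu(a)}\to P'_{1,\le\nu(a)+\deg_\partial(a_\partial)},\ p\mapsto p\cdot a,\text{ is injective}\}.$$ (2) $\mathcal{C}'_{\mathbb{A}_1}=\theta({}'\mathcal{C}_{\mathbb{A}_1})$. -/

import Mathlib

open Polynomial

namespace Jacobian

noncomputable section

/-! ### The Jacobian algebra `𝔸₁`, acting on the polynomial algebra `K[x]` -/

/-- The operator of multiplication by `x` on `K[x]`. -/
def opX (K : Type*) [Field K] : Module.End K K[X] := LinearMap.mulLeft K X

/-- The operator `∂ = d/dx` on `K[x]`. -/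
def opD (K : Type*) [Field K] : Module.End K K[X] := Polynomial.derivative

/-- The operator `H = ∂ x` on `K[x]`. -/
def opH (K : Type*) [Field K] : Module.End K K[X] := opD K * opX K

/-- The diagonal operator `x ^ k ↦ f k • x ^ k`. -/
def diag {K : Type*} [Field K] (f : ℕ → K) : Module.End K K[X] :=
  Polynomial.lsum fun k => f k • Polynomial.monomial k

/-- The operator `H⁻¹`, that is `x ^ k ↦ x ^ k / (k + 1)`. -/
def opHinv (K : Type*) [Field K] : Module.End K K[X] := diag fun k => ((k : K) + 1)⁻¹

/-- The matrix unit `E i j` : it sends `x ^ j` to `x ^ i` and the other monomials to `0`. -/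
def E (K : Type*) [Field K] (i j : ℕ) : Module.End K K[X] :=
  Polynomial.monomial i ∘ₗ Polynomial.lcoeff K j

theorem diag_monomial {K : Type*} [Field K] (f : ℕ → K) (k : ℕ) (c : K) :
    diag f (monomial k c) = monomial k (f k * c) := by
  simp [diag, Polynomial.lsum_apply, Polynomial.smul_monomial]

theorem opX_monomial {K : Type*} [Field K] (k : ℕ) (c : K) :
    opX K (monomial k c) = monomial (k + 1) c := by
  simp [opX]

theorem opD_monomial {K : Type*} [Field K] (k : ℕ) (c : K) :
    opD K (monomial k c) = monomial (k - 1) (c * k) := by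
  simp [opD, Polynomial.derivative_monomial]

theorem opH_eq_diag (K : Type*) [Field K] : opH K = diag fun k => (k : K) + 1 := by
  refine Polynomial.lhom_ext' fun k => LinearMap.ext fun c => ?_
  simp [opH, opX_monomial, opD_monomial, diag_monomial, mul_comm]

/-- `diag` is an algebra homomorphism. -/
def diagHom (K : Type*) [Field K] : (ℕ → K) →ₐ[K] Module.End K K[X] where
  toFun := diag
  map_one' := by
    refine Polynomial.lhom_ext' fun k => LinearMap.ext fun c => ?_
    simp [diag_monomial]
  map_mul' f g := by
    refine Polynomial.lhom_ext' fun k => LinearMap.ext fun c => ?_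
    simp [diag_monomial, mul_assoc]
  map_zero' := by
    refine Polynomial.lhom_ext' fun k => LinearMap.ext fun c => ?_
    simp [diag_monomial]
  map_add' f g := by
    refine Polynomial.lhom_ext' fun k => LinearMap.ext fun c => ?_
    simp [diag_monomial, add_mul]
  commutes' r := by
    refine Polynomial.lhom_ext' fun k => LinearMap.ext fun c => ?_
    simp [diag_monomial, Polynomial.smul_monomial]

theorem opH_mul_opHinv (K : Type*) [Field K] [CharZero K] : opH K * opHinv K = 1 := by
  rw [opH_eq_diag]
  refine ((diagHom K).map_mul _ _).symm.trans ?_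
  rw [← (diagHom K).map_one]
  congr 1
  funext k
  exact mul_inv_cancel₀ (Nat.cast_add_one_ne_zero k)

theorem opHinv_mul_opH (K : Type*) [Field K] [CharZero K] : opHinv K * opH K = 1 := by
  rw [opH_eq_diag]
  refine ((diagHom K).map_mul _ _).symm.trans ?_
  rw [← (diagHom K).map_one]
  congr 1
  funext k
  exact inv_mul_cancel₀ (Nat.cast_add_one_ne_zero k)

/-- The Jacobian algebra `𝔸₁`: the subalgebra of `End_K (K[x])` generated by the Weyl algebra
`K⟨x, ∂⟩` and by `H⁻¹`. -/
def A1 (K : Type*) [Field K] : Subalgebra K (Module.End K K[X]) :=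
  Algebra.adjoin K {opX K, opD K, opHinv K}

/-- The set `'𝒞` of left regular elements of a ring: those `a` for which the right multiplication
`b ↦ b * a` is injective. (In Mathlib such an element is called `IsRightRegular`.) -/
def leftRegular (R : Type*) [Ring R] : Set R := {a | Function.Injective fun b : R => b * a}

/-- The set `𝒞'` of right regular elements of a ring: those `a` for which the left multiplication
`b ↦ a * b` is injective. (In Mathlib such an element is called `IsLeftRegular`.) -/
def rightRegular (R : Type*) [Ring R] : Set R := {a | Function.Injective fun b : R => a * b}

/-! ### The involution `θ` and the right module `P₁' = K[∂]` -/

/-- The symmetric bilinear form on `K[x]` with `(x ^ i, x ^ j) = i! δ_{ij}`. -/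
def form (K : Type*) [Field K] : K[X] →ₗ[K] K[X] →ₗ[K] K :=
  Polynomial.lsum fun k =>
    LinearMap.toSpanSingleton K _ ((k.factorial : K) • Polynomial.lcoeff K k)

theorem form_monomial {K : Type*} [Field K] (k : ℕ) (c : K) (q : K[X]) :
    form K (monomial k c) q = c * (k.factorial * q.coeff k) := by
  simp [form, Polynomial.lsum_apply, Polynomial.sum_monomial_index]

theorem form_symm {K : Type*} [Field K] (p q : K[X]) : form K p q = form K q p := by
  have h : form K = (form K).flip := by
    refine Polynomial.lhom_ext' fun k => LinearMap.ext fun c => ?_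
    refine Polynomial.lhom_ext' fun l => LinearMap.ext fun e => ?_
    simp only [LinearMap.comp_apply, LinearMap.flip_apply, form_monomial,
      Polynomial.coeff_monomial]
    by_cases hkl : k = l
    · subst hkl; simp; ring
    · simp [hkl, Ne.symm hkl]
  exact congrArg (fun f => f p q) h

theorem form_nondegenerate {K : Type*} [Field K] [CharZero K] {p p' : K[X]}
    (h : ∀ q, form K p q = form K p' q) : p = p' := by
  ext k
  have hk := h (monomial k 1)
  rw [form_symm p, form_symm p', form_monomial, form_monomial] at hk
  have : (k.factorial : K) ≠ 0 := Nat.cast_ne_zero.2 k.factorial_ne_zero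
  simpa [this] using hk

/-- `b` is adjoint to `a` with respect to the form. -/
def IsAdj {K : Type*} [Field K] (a b : Module.End K K[X]) : Prop :=
  ∀ p q : K[X], form K p (a q) = form K (b p) q

theorem IsAdj.symm {K : Type*} [Field K] {a b : Module.End K K[X]} (h : IsAdj a b) :
    IsAdj b a := fun p q => by rw [form_symm, ← h, form_symm]

theorem IsAdj.unique {K : Type*} [Field K] [CharZero K] {a b b' : Module.End K K[X]}
    (h : IsAdj a b) (h' : IsAdj a b') : b = b' :=
  LinearMap.ext fun p => form_nondegenerate fun q => by rw [← h, ← h']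

theorem IsAdj.mul {K : Type*} [Field K] {a b a' b' : Module.End K K[X]}
    (h : IsAdj a b) (h' : IsAdj a' b') : IsAdj (a * a') (b' * b) := fun p q => by
  rw [Module.End.mul_apply, Module.End.mul_apply, h, h']

theorem IsAdj.add {K : Type*} [Field K] {a b a' b' : Module.End K K[X]}
    (h : IsAdj a b) (h' : IsAdj a' b') : IsAdj (a + a') (b + b') := fun p q => by
  simp [h p q, h' p q]

theorem IsAdj.smul {K : Type*} [Field K] {a b : Module.End K K[X]} (c : K)
    (h : IsAdj a b) : IsAdj (c • a) (c • b) := fun p q => by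
  simp [h p q]

theorem isAdj_one (K : Type*) [Field K] : IsAdj (1 : Module.End K K[X]) 1 := fun _ _ => rfl

theorem isAdj_of_monomial {K : Type*} [Field K] {a b : Module.End K K[X]}
    (h : ∀ k l, form K (monomial k 1) (a (monomial l 1)) = form K (b (monomial k 1)) (monomial l 1)) :
    IsAdj a b := by
  have h' : (form K).compl₂ a = (form K).comp b := by
    refine Polynomial.lhom_ext' fun k => LinearMap.ext_ring ?_
    refine Polynomial.lhom_ext' fun l => LinearMap.ext_ring ?_
    simpa using h k l
  exact fun p q => congrArg (fun f => f p q) h'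

theorem isAdj_diag {K : Type*} [Field K] (f : ℕ → K) : IsAdj (diag f) (diag f) := by
  refine isAdj_of_monomial fun k l => ?_
  simp only [diag_monomial, form_monomial, Polynomial.coeff_monomial]
  by_cases hkl : l = k
  · subst hkl; simp; ring
  · simp [hkl]

theorem isAdj_opX (K : Type*) [Field K] : IsAdj (opX K) (opD K) := by
  refine isAdj_of_monomial fun k l => ?_
  simp only [opX_monomial, opD_monomial, form_monomial, Polynomial.coeff_monomial]
  rcases k with _ | k
  · simp
  · by_cases hkl : l = k
    · subst hkl; simp [Nat.factorial_succ]
    · simp [hkl]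

theorem opX_mem (K : Type*) [Field K] : opX K ∈ A1 K := Algebra.subset_adjoin (by simp)

theorem opD_mem (K : Type*) [Field K] : opD K ∈ A1 K := Algebra.subset_adjoin (by simp)

theorem opHinv_mem (K : Type*) [Field K] : opHinv K ∈ A1 K := Algebra.subset_adjoin (by simp)

theorem exists_isAdj {K : Type*} [Field K] (a : A1 K) :
    ∃ b : A1 K, IsAdj (a : Module.End K K[X]) b := by
  obtain ⟨a, ha⟩ := a
  induction ha using Algebra.adjoin_induction with
  | mem a ha =>
    rcases ha with rfl | rfl | rfl
    · exact ⟨⟨_, opD_mem K⟩, isAdj_opX K⟩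
    · exact ⟨⟨_, opX_mem K⟩, (isAdj_opX K).symm⟩
    · exact ⟨⟨_, opHinv_mem K⟩, isAdj_diag _⟩
  | algebraMap c =>
    refine ⟨algebraMap K (A1 K) c, ?_⟩
    have := (isAdj_one K).smul c
    simpa [Algebra.algebraMap_eq_smul_one] using this
  | add a b _ _ iha ihb =>
    obtain ⟨a', ha'⟩ := iha
    obtain ⟨b', hb'⟩ := ihb
    exact ⟨a' + b', ha'.add hb'⟩
  | mul a b _ _ iha ihb =>
    obtain ⟨a', ha'⟩ := iha
    obtain ⟨b', hb'⟩ := ihb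
    exact ⟨b' * a', ha'.mul hb'⟩

theorem exists_isAdj_spec {K : Type*} [Field K] (a : A1 K) :
    IsAdj (a : Module.End K K[X]) ((exists_isAdj a).choose : A1 K) := (exists_isAdj a).choose_spec

/-- The involution `θ` of `𝔸₁`, built as the adjoint with respect to the form. It is the
anti-homomorphism determined by `x ↦ ∂`, `∂ ↦ x`, `H⁻¹ ↦ H⁻¹`, see `theta_one`, `theta_mul`,
`theta_theta`, `theta_opX`, `theta_opD`, `theta_opHinv`. -/
def theta (K : Type*) [Field K] [CharZero K] : A1 K →ₗ[K] A1 K where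
  toFun a := (exists_isAdj a).choose
  map_add' a b := Subtype.ext <|
    (exists_isAdj_spec (a + b)).unique ((exists_isAdj_spec a).add (exists_isAdj_spec b))
  map_smul' c a := Subtype.ext <|
    (exists_isAdj_spec (c • a)).unique ((exists_isAdj_spec a).smul c)

theorem isAdj_theta {K : Type*} [Field K] [CharZero K] (a : A1 K) :
    IsAdj (a : Module.End K K[X]) (theta K a) := exists_isAdj_spec a

theorem theta_one (K : Type*) [Field K] [CharZero K] : theta K 1 = 1 :=
  Subtype.ext ((isAdj_theta _).unique (isAdj_one K))

theorem theta_mul {K : Type*} [Field K] [CharZero K] (a b : A1 K) :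
    theta K (a * b) = theta K b * theta K a :=
  Subtype.ext ((isAdj_theta _).unique ((isAdj_theta a).mul (isAdj_theta b)))

theorem theta_theta {K : Type*} [Field K] [CharZero K] (a : A1 K) :
    theta K (theta K a) = a :=
  Subtype.ext ((isAdj_theta _).unique (isAdj_theta a).symm)

theorem theta_opX (K : Type*) [Field K] [CharZero K] :
    theta K ⟨opX K, opX_mem K⟩ = ⟨opD K, opD_mem K⟩ :=
  Subtype.ext ((isAdj_theta _).unique (isAdj_opX K))

theorem theta_opD (K : Type*) [Field K] [CharZero K] :
    theta K ⟨opD K, opD_mem K⟩ = ⟨opX K, opX_mem K⟩ :=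
  Subtype.ext ((isAdj_theta _).unique (isAdj_opX K).symm)

theorem theta_opHinv (K : Type*) [Field K] [CharZero K] :
    theta K ⟨opHinv K, opHinv_mem K⟩ = ⟨opHinv K, opHinv_mem K⟩ :=
  Subtype.ext ((isAdj_theta _).unique (isAdj_diag _))

/-- The right action `p ↦ p a` of `a ∈ 𝔸₁` on the right module `P₁' = K[∂]`, which is
`𝔸₁ / x 𝔸₁` with `∂ ^ k` for the class of `∂ ^ k`. An element of `P₁'` is written as a polynomial
whose indeterminate stands for `∂`; the action is given by the rule `p a := θ(a) p`. -/
def rightAct {K : Type*} [Field K] [CharZero K] (a : A1 K) : K[X] →ₗ[K] K[X] :=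
  (theta K a : Module.End K K[X])

theorem rightAct_mul {K : Type*} [Field K] [CharZero K] (a b : A1 K) (p : K[X]) :
    rightAct (a * b) p = rightAct b (rightAct a p) := by
  simp [rightAct, theta_mul]

theorem rightAct_opD {K : Type*} [Field K] [CharZero K] (p : K[X]) :
    rightAct ⟨opD K, opD_mem K⟩ p = p * X := by
  simp [rightAct, theta_opD, opX, mul_comm]

theorem rightAct_opX_one (K : Type*) [Field K] [CharZero K] :
    rightAct ⟨opX K, opX_mem K⟩ 1 = 0 := by
  simp [rightAct, theta_opX, opD]

/-! ### The algebra `𝔻₁ = L ⊕ L^⊥` -/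

/-- The algebra `K[H, H⁻¹, (H + 1)⁻¹, (H + 2)⁻¹, …]` of rational functions in `H`. -/
def Lrat (K : Type*) [Field K] : Subalgebra K (RatFunc K) :=
  Algebra.adjoin K ({RatFunc.X} ∪ Set.range fun i : ℕ => (RatFunc.X + (i : RatFunc K))⁻¹)

theorem eval_denom_ne_zero {K : Type*} [Field K] [CharZero K] (r : Lrat K) (k : ℕ) :
    (r : RatFunc K).denom.eval₂ (RingHom.id K) ((k : K) + 1) ≠ 0 := by
  obtain ⟨r, hr⟩ := r
  induction hr using Algebra.adjoin_induction with
  | mem r hr =>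
    rcases hr with rfl | ⟨i, rfl⟩
    · simp
    · intro h0
      have hX : (RatFunc.X + (i : RatFunc K)) = algebraMap K[X] (RatFunc K) (X + (i : K[X])) := by
        simp
      have hne : (X + (i : K[X])) ≠ 0 := by
        simpa using Polynomial.X_add_C_ne_zero (i : K)
      have hne' : (RatFunc.X + (i : RatFunc K)) ≠ 0 := by
        rw [hX]; exact RatFunc.algebraMap_ne_zero hne
      have h := Polynomial.eval₂_eq_zero_of_dvd_of_eval₂_eq_zero (RingHom.id K) ((k : K) + 1)
        (RatFunc.denom_inv_dvd hne') h0
      rw [hX, RatFunc.num_algebraMap] at h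
      simp only [Polynomial.eval₂_add, Polynomial.eval₂_X, Polynomial.eval₂_natCast] at h
      have : ((k + i + 1 : ℕ) : K) = 0 := by push_cast; linear_combination h
      exact absurd (Nat.cast_eq_zero.1 this) (by omega)
  | algebraMap c =>
    simp
  | add a b _ _ iha ihb =>
    intro h
    have := Polynomial.eval₂_eq_zero_of_dvd_of_eval₂_eq_zero _ _ (RatFunc.denom_add_dvd a b) h
    rw [Polynomial.eval₂_mul] at this
    exact (mul_ne_zero iha ihb) this
  | mul a b _ _ iha ihb =>
    intro h
    have := Polynomial.eval₂_eq_zero_of_dvd_of_eval₂_eq_zero _ _ (RatFunc.denom_mul_dvd a b) h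
    rw [Polynomial.eval₂_mul] at this
    exact (mul_ne_zero iha ihb) this

/-- The values `k ↦ r (k + 1)` of a rational function `r ∈ K[H, H⁻¹, (H + 1)⁻¹, …]`. -/
def values (K : Type*) [Field K] [CharZero K] : Lrat K →ₐ[K] (ℕ → K) where
  toFun r k := (r : RatFunc K).eval (RingHom.id K) ((k : K) + 1)
  map_one' := by funext k; simp
  map_zero' := by funext k; simp
  map_add' r s := by
    funext k
    exact RatFunc.eval_add _ _ (eval_denom_ne_zero r k) (eval_denom_ne_zero s k)
  map_mul' r s := by
    funext k
    exact RatFunc.eval_mul _ _ (eval_denom_ne_zero r k) (eval_denom_ne_zero s k)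
  commutes' c := by
    funext k
    simp [RatFunc.algebraMap_eq_C]

/-- The algebra homomorphism `r ↦ r(H)`. As `H` is the diagonal operator with entries `k + 1`,
the operator `r(H)` is the diagonal operator with entries `r (k + 1)`. -/
def atH (K : Type*) [Field K] [CharZero K] : Lrat K →ₐ[K] Module.End K K[X] :=
  (diagHom K).comp (values K)

theorem X_mem_Lrat (K : Type*) [Field K] : RatFunc.X ∈ Lrat K := Algebra.subset_adjoin (by simp)

theorem atH_X (K : Type*) [Field K] [CharZero K] : atH K ⟨RatFunc.X, X_mem_Lrat K⟩ = opH K := by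
  rw [opH_eq_diag]
  change diag _ = _
  congr 1
  funext k
  simp [values]

/-- The coordinates of the elements of `𝔻₁ = L ⊕ L^⊥`: a rational function `l` and the
coefficients `λ i j` (`i, j ≥ 1`) of `l^⊥ = ∑ λ i j • x ^ i H⁻ʲ ∂ ^ i`. -/
abbrev DElt (K : Type*) [Field K] : Type _ := Lrat K × (ℕ+ × ℕ+ →₀ K)

/-- `λ ↦ ∑ λ i j • x ^ i H⁻ʲ ∂ ^ i`. -/
def perpOp (K : Type*) [Field K] : (ℕ+ × ℕ+ →₀ K) →ₗ[K] Module.End K K[X] :=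
  Finsupp.linearCombination K fun p =>
    opX K ^ (p.1 : ℕ) * opHinv K ^ (p.2 : ℕ) * opD K ^ (p.1 : ℕ)

/-- The element `l + l^⊥` of `𝔻₁` with given coordinates. -/
def op (K : Type*) [Field K] [CharZero K] : DElt K →ₗ[K] Module.End K K[X] :=
  (atH K).toLinearMap.coprod (perpOp K)

/-- `L^⊥`, the span of the elements `x ^ i H⁻ʲ ∂ ^ i`, `i, j ≥ 1`. -/
def Lperp (K : Type*) [Field K] : Submodule K (Module.End K K[X]) := LinearMap.range (perpOp K)

/-- `𝔻₁ = L + L^⊥`. -/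
def D1 (K : Type*) [Field K] [CharZero K] : Submodule K (Module.End K K[X]) :=
  LinearMap.range (op K)

/-- The ideal `F` of `𝔸₁`, the span of the matrix units. -/
def F (K : Type*) [Field K] : Submodule K (Module.End K K[X]) :=
  Submodule.span K (Set.range fun p : ℕ × ℕ => E K p.1 p.2)

/-- The span of the matrix units `E i j` with `i, j ≤ n`. -/
def Fle (K : Type*) [Field K] (n : ℕ) : Submodule K (Module.End K K[X]) :=
  Submodule.span K {e | ∃ i j : ℕ, i ≤ n ∧ j ≤ n ∧ e = E K i j}

open Classical in
/-- The size of an element of `F`. -/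
def size {K : Type*} [Field K] (f : Module.End K K[X]) : ℤ :=
  if f = 0 then -1 else (sInf {n : ℕ | f ∈ Fle K n} : ℕ)

/-- `∑_{i ≥ 1} x ^ i 𝔻₁`. -/
def xD1 (K : Type*) [Field K] [CharZero K] : Submodule K (Module.End K K[X]) :=
  ⨆ i : ℕ+, (D1 K).map (LinearMap.mulLeft K (opX K ^ (i : ℕ)))

/-- The set `Ξ = (⨁_{i ≥ 0} L^⊥ ∂ ^ i ⊕ ⨁_{i ≥ 1} x ^ i 𝔻₁) ∪ (⨁_{i ≥ 1} x ^ i 𝔻₁ + F)`. -/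
def Xi (K : Type*) [Field K] [CharZero K] : Set (Module.End K K[X]) :=
  {a | a ∈ (⨆ i : ℕ, (Lperp K).map (LinearMap.mulRight K (opD K ^ i))) ⊔ xD1 K} ∪
    {a | a ∈ xD1 K ⊔ F K}

/-! ### The invariants `δ`, `φ`, `μ`, `ν` -/

/-- `φ(l^⊥) = ∑ λ i j (H - i)(H - i + 1) ⋯ (H - 1) / (H - i) ^ j`. -/
def phi (K : Type*) [Field K] : (ℕ+ × ℕ+ →₀ K) →ₗ[K] RatFunc K :=
  Finsupp.linearCombination K fun p =>
    (∏ t ∈ Finset.Icc 1 (p.1 : ℕ), (RatFunc.X - (t : RatFunc K))) /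
      (RatFunc.X - ((p.1 : ℕ) : RatFunc K)) ^ (p.2 : ℕ)

/-- `δ(l^⊥)`, the largest `i` such that `λ i j ≠ 0` for some `j`; it is `0` if `l^⊥ = 0`. -/
def delta {K : Type*} [Field K] (c : ℕ+ × ℕ+ →₀ K) : ℕ := c.support.sup fun p => (p.1 : ℕ)

/-- `τ ^ i (f) = f (H + i)` for a rational function `f`. -/
def tau {K : Type*} [Field K] (i : ℕ) (f : RatFunc K) : RatFunc K :=
  f.eval RatFunc.C (RatFunc.X + (i : RatFunc K))

/-- The set of `i ≥ δ(l^⊥)` such that `τ ^ i (l + φ(l^⊥))` has no root in `{1, 2, …}`. -/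
def muSet {K : Type*} [Field K] (d : DElt K) : Set ℕ :=
  {i | delta d.2 ≤ i ∧
    ∀ m : ℕ, 1 ≤ m → ¬ (tau i ((d.1 : RatFunc K) + phi K d.2)).num.IsRoot (m : K)}

/-- `μ(d)` for `d = l + l^⊥ ∈ 𝔻₁`. -/
def mu {K : Type*} [Field K] (d : DElt K) : ℕ := sInf (muSet d)

/-- A decomposition `a = ∑_{i ≥ 0} d_{-i} ∂ ^ i + ∑_{j ≥ 1} x ^ j d_j + a_F` of an element of `𝔸₁`
with `d_k ∈ 𝔻₁` (`neg i` is `d_{-i}` and `pos j` is `d_j`) and `a_F ∈ F`. -/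
structure Decomp {K : Type*} [Field K] [CharZero K] (a : A1 K) where
  neg : ℕ →₀ DElt K
  pos : ℕ+ →₀ DElt K
  aF : Module.End K K[X]
  aF_mem : aF ∈ F K
  eq_sum : (a : Module.End K K[X]) =
    (neg.sum fun i d => op K d * opD K ^ i) + (pos.sum fun j d => opX K ^ (j : ℕ) * op K d) + aF

/-- The degree `deg_∂ (a_∂)` of `a_∂ = ∑ d_{-i} ∂ ^ i`. -/
def Decomp.deg {K : Type*} [Field K] [CharZero K] {a : A1 K} (D : Decomp a) : ℕ :=
  D.neg.support.sup id

/-- The leading coefficient `d_{-n}` of `a_∂`, where `n = deg_∂ (a_∂)`. -/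
def Decomp.lead {K : Type*} [Field K] [CharZero K] {a : A1 K} (D : Decomp a) : DElt K :=
  D.neg D.deg

/-- The leading coefficient of `a_∂` does not lie in `F`. -/
def Decomp.Reduced {K : Type*} [Field K] [CharZero K] {a : A1 K} (D : Decomp a) : Prop :=
  op K D.lead ∉ F K

/-- `ν = max (s(a_F), μ(d_{-n}))`, a natural number since `μ ≥ 0`. -/
def Decomp.nu {K : Type*} [Field K] [CharZero K] {a : A1 K} (D : Decomp a) : ℕ :=
  (max (size D.aF) (mu D.lead : ℤ)).toNat

end

end Jacobian

namespace Jacobian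

noncomputable section

/-! ### Diagonal operators and their sequences of diagonal entries. -/

section

variable {K : Type*} [Field K]

/-! Everything is read off from matrices in the basis of monomials. By adjunction, the matrix of the
right action of `a` on `K[∂]` is, up to factorials, the transpose of the matrix of `a`
(`factorial_mul_coeff_rightAct`). Left regularity of `a` is the same as injectivity of this right
action (`mem_leftRegular_iff`): if `p` is killed by `a`, the rank-one operator `q ↦ (p, q)` lies in
`F` and is killed by right multiplication by `a`; the converse follows from `θ` reversing products.

Let `a` have a reduced decomposition with `n = deg_∂ (a_∂)`. In a column `l > ν(a)` the summand
`a_F` is invisible, the summands `x ^ j d_j` live strictly below the diagonal, and `d_{-i} ∂ ^ i`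
lives on the `i`-th superdiagonal. So the outermost superdiagonal is given by `d_{-n}` alone
(`Decomp.entry_eq`), and `μ` is chosen so that the diagonal entries of `d_{-n}` do not vanish from
`μ` on (`entries_ne_zero`). Hence a polynomial of degree `k > ν(a)` is sent to one of degree exactly
`k + n`, and injectivity need only be tested in degrees at most `ν(a)`.

Elements of `Ξ` never act injectively (`not_injective_of_mem_Xi`): those of the first kind have zero
row `0`, so they kill `1`; those of the second kind map polynomials of degree at most `s + 1` to
degree at most `s` for some `s`.

Existence of reduced decompositions rests on identifying the diagonals available in `𝔻₁`: they
include all sequences which agree, up to finitely many terms, with a rational function of `H` with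
integral poles (`seqAlg_le_diagD1`). These sequences are stable under shifts, so the sums `∑ d_{-i}
∂ ^ i + ∑ x ^ j d_j` are stable under left multiplication by the generators of `𝔸₁`
(`A1_le_range_decompOp`). -/

theorem diag_mul (f g : ℕ → K) : diag f * diag g = diag (f * g) :=
  ((diagHom K).map_mul f g).symm

theorem opX_pow_monomial (n k : ℕ) (c : K) :
    (opX K ^ n) (monomial k c) = monomial (k + n) c := by
  induction n with
  | zero => simp
  | succ n ih => rw [pow_succ', Module.End.mul_apply, ih, opX_monomial, add_assoc]

theorem opD_pow_monomial (n k : ℕ) (c : K) :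
    (opD K ^ n) (monomial k c) = monomial (k - n) (c * k.descFactorial n) := by
  induction n with
  | zero => simp
  | succ n ih =>
    rw [pow_succ', Module.End.mul_apply, ih, opD_monomial, Nat.descFactorial_succ]
    congr 1
    push_cast
    ring

theorem end_ext {a b : Module.End K K[X]}
    (h : ∀ k, a (monomial k 1) = b (monomial k 1)) : a = b :=
  Polynomial.lhom_ext' fun k => LinearMap.ext_ring (h k)

theorem opHinv_pow (n : ℕ) :
    opHinv K ^ n = diag fun k => (((k : K) + 1)⁻¹) ^ n :=
  ((diagHom K).map_pow _ n).symm

/-- The sequence of diagonal entries of `x ^ i H⁻ʲ ∂ ^ i`. -/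
def perpSeq (K : Type*) [Field K] (i j : ℕ) : ℕ → K := fun k =>
  k.descFactorial i * ((((k - i : ℕ) : K) + 1)⁻¹) ^ j

theorem opX_opHinv_opD (i j : ℕ) :
    opX K ^ i * opHinv K ^ j * opD K ^ i = diag (perpSeq K i j) := by
  refine end_ext fun k => ?_
  rw [Module.End.mul_apply, Module.End.mul_apply, opD_pow_monomial, opHinv_pow, diag_monomial,
    opX_pow_monomial, diag_monomial, perpSeq]
  rcases lt_or_ge k i with h | h
  · simp [Nat.descFactorial_of_lt h]
  · rw [Nat.sub_add_cancel h]
    congr 1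
    ring

/-- The sequence of diagonal entries of `H`. -/
def hSeq (K : Type*) [Field K] : ℕ → K := fun k => k + 1

/-- The sequence of diagonal entries of `(H + m)⁻¹`, with the value `0` at a pole. -/
def invSeq (K : Type*) [Field K] (m : ℤ) : ℕ → K := fun k => ((k : K) + 1 + m)⁻¹

/-- The algebra of sequences which are eventually the values of a rational function in `H`
with integral poles. -/
def seqAlg (K : Type*) [Field K] : Subalgebra K (ℕ → K) :=
  Algebra.adjoin K ({hSeq K} ∪ Set.range (invSeq K) ∪ Set.range fun i : ℕ => Pi.single i (1 : K))

theorem hSeq_mem : hSeq K ∈ seqAlg K := Algebra.subset_adjoin (by simp)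

theorem invSeq_mem (m : ℤ) : invSeq K m ∈ seqAlg K := Algebra.subset_adjoin (by simp)

theorem single_mem (i : ℕ) : (Pi.single i 1 : ℕ → K) ∈ seqAlg K := Algebra.subset_adjoin (by simp)

theorem eq_sum_single {f : ℕ → K} {N : ℕ} (h : ∀ k, N ≤ k → f k = 0) :
    f = ∑ i ∈ Finset.range N, f i • (Pi.single i 1 : ℕ → K) := by
  funext k
  rw [Finset.sum_apply]
  by_cases hk : k < N
  · rw [Finset.sum_eq_single k]
    · simp
    · intro b _ hb
      simp [hb.symm]
    · simp [hk]
  · rw [h k (not_lt.1 hk), Finset.sum_eq_zero]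
    intro b hb
    have : k ≠ b := by rintro rfl; exact hk (Finset.mem_range.1 hb)
    simp [this]

/-- Finitely many values may be changed freely, so the junk values at poles and those of truncated
subtraction never matter. -/
theorem mem_of_eventually_eq {V : Submodule K (ℕ → K)}
    (hV : ∀ i : ℕ, (Pi.single i 1 : ℕ → K) ∈ V) {f g : ℕ → K} (hf : f ∈ V) (N : ℕ)
    (h : ∀ k, N ≤ k → g k = f k) : g ∈ V := by
  have : g - f ∈ V := by
    rw [eq_sum_single (f := g - f) (N := N) fun k hk => by simp [h k hk]]
    exact V.sum_mem fun i _ => V.smul_mem _ (hV i)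
  simpa using V.add_mem this hf

theorem seqAlg_mem_of_eventually_eq {f g : ℕ → K} (hf : f ∈ seqAlg K) (N : ℕ)
    (h : ∀ k, N ≤ k → g k = f k) : g ∈ seqAlg K :=
  mem_of_eventually_eq (V := Subalgebra.toSubmodule (seqAlg K)) single_mem hf N h

/-- The span of the singletons, the powers of `H` and the powers of the `(H + m)⁻¹`. -/
def seqSpan (K : Type*) [Field K] : Submodule K (ℕ → K) :=
  Submodule.span K ((Set.range fun i : ℕ => Pi.single i (1 : K)) ∪
    (Set.range fun n : ℕ => hSeq K ^ n) ∪ Set.range fun p : ℤ × ℕ => invSeq K p.1 ^ p.2)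

theorem seqSpan_single (i : ℕ) : (Pi.single i 1 : ℕ → K) ∈ seqSpan K :=
  Submodule.subset_span (Or.inl (Or.inl ⟨i, rfl⟩))

theorem seqSpan_hSeq_pow (n : ℕ) : hSeq K ^ n ∈ seqSpan K :=
  Submodule.subset_span (Or.inl (Or.inr ⟨n, rfl⟩))

theorem seqSpan_invSeq_pow (m : ℤ) (n : ℕ) : invSeq K m ^ n ∈ seqSpan K :=
  Submodule.subset_span (Or.inr ⟨(m, n), rfl⟩)

theorem aeval_hSeq_apply (p : K[X]) (k : ℕ) : aeval (hSeq K) p k = p.eval ((k : K) + 1) := by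
  simp [hSeq]

/-- The polynomial `(H - 1) ⋯ (H - i)` is the one that represents `x ^ i ∂ ^ i`. -/
theorem eval_prod_natCast (i k : ℕ) :
    (∏ t ∈ Finset.range i, (X - C ((t : K) + 1)) : K[X]).eval ((k : K) + 1) = k.descFactorial i := by
  induction i with
  | zero => simp
  | succ i ih =>
    rw [Finset.prod_range_succ, eval_mul, ih, Nat.descFactorial_succ]
    simp only [eval_sub, eval_X, eval_C]
    rcases lt_or_ge k i with h | h
    · simp [Nat.descFactorial_of_lt h]
    · push_cast [h]
      ring

/-! ### Partial fractions, and the diagonals contained in `𝔻₁`. -/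

variable [CharZero K]

theorem natCast_add_ne_zero {k : ℕ} {m : ℤ} (h : m.natAbs ≤ k) : (k : K) + 1 + m ≠ 0 := by
  have : ((k + 1 + m : ℤ) : K) ≠ 0 := Int.cast_ne_zero.2 (by omega)
  push_cast at this
  exact this

theorem hSeq_mul_mem {f : ℕ → K} (hf : f ∈ seqSpan K) : hSeq K * f ∈ seqSpan K := by
  induction hf using Submodule.span_induction with
  | mem f hf =>
    rcases hf with (⟨i, rfl⟩ | ⟨n, rfl⟩) | ⟨⟨m, n⟩, rfl⟩
    · refine mem_of_eventually_eq seqSpan_single (zero_mem _) (i + 1) fun k hk => ?_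
      have : k ≠ i := by omega
      simp [this]
    · change hSeq K * hSeq K ^ n ∈ _
      rw [← pow_succ']
      exact seqSpan_hSeq_pow _
    · rcases n with _ | n
      · simpa using seqSpan_hSeq_pow (K := K) 1
      · refine mem_of_eventually_eq seqSpan_single (sub_mem (seqSpan_invSeq_pow m n)
          ((seqSpan K).smul_mem (m : K) (seqSpan_invSeq_pow m (n + 1)))) m.natAbs fun k hk => ?_
        have := natCast_add_ne_zero (K := K) hk
        simp only [hSeq, invSeq, Pi.mul_apply, Pi.pow_apply, Pi.sub_apply, Pi.smul_apply,
          smul_eq_mul]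
        rw [pow_succ]
        field_simp
        ring
  | zero => simp
  | add f g _ _ hf hg => rw [mul_add]; exact add_mem hf hg
  | smul c f _ hf => rw [mul_smul_comm]; exact (seqSpan K).smul_mem _ hf

theorem invSeq_mul_mem (a : ℤ) {f : ℕ → K} (hf : f ∈ seqSpan K) :
    invSeq K a * f ∈ seqSpan K := by
  induction hf using Submodule.span_induction with
  | mem f hf =>
    rcases hf with (⟨i, rfl⟩ | ⟨n, rfl⟩) | ⟨⟨m, n⟩, rfl⟩
    · refine mem_of_eventually_eq seqSpan_single (zero_mem _) (i + 1) fun k hk => ?_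
      have : k ≠ i := by omega
      simp [this]
    · induction n with
      | zero => simpa using seqSpan_invSeq_pow (K := K) a 1
      | succ n ih =>
        refine mem_of_eventually_eq seqSpan_single (sub_mem (seqSpan_hSeq_pow n)
          ((seqSpan K).smul_mem (a : K) ih)) a.natAbs fun k hk => ?_
        have := natCast_add_ne_zero (K := K) hk
        simp only [hSeq, invSeq, Pi.mul_apply, Pi.pow_apply, Pi.sub_apply, Pi.smul_apply,
          smul_eq_mul]
        rw [pow_succ]
        field_simp
        ring
    · by_cases ham : a = m
      · subst ham
        change invSeq K a * invSeq K a ^ n ∈ _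
        rw [← pow_succ']
        exact seqSpan_invSeq_pow _ _
      · induction n with
        | zero => simpa using seqSpan_invSeq_pow (K := K) a 1
        | succ n ih =>
          -- This is `1 / ((H + a)(H + m)) = (1 / (H + a) - 1 / (H + m)) / (m - a)`, multiplied by
          -- `(H + m)⁻ⁿ`.
          refine mem_of_eventually_eq seqSpan_single ((seqSpan K).smul_mem ((m - a : K)⁻¹)
            (sub_mem ih (seqSpan_invSeq_pow m (n + 1)))) (max a.natAbs m.natAbs) fun k hk => ?_
          have h1 := natCast_add_ne_zero (K := K) ((le_max_left _ _).trans hk)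
          have h2 := natCast_add_ne_zero (K := K) ((le_max_right _ _).trans hk)
          have h3 : (m : K) - a ≠ 0 := by
            rw [sub_ne_zero]; exact_mod_cast Ne.symm ham
          simp only [invSeq, Pi.mul_apply, Pi.pow_apply, Pi.sub_apply, Pi.smul_apply,
            smul_eq_mul]
          rw [pow_succ]
          field_simp
          ring
  | zero => simp
  | add f g _ _ hf hg => rw [mul_add]; exact add_mem hf hg
  | smul c f _ hf => rw [mul_smul_comm]; exact (seqSpan K).smul_mem _ hf

/-- Partial fraction decomposition: the span contains `1` and is stable under multiplication by each
generator. -/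
theorem seqAlg_le_seqSpan {f : ℕ → K} (hf : f ∈ seqAlg K) : f ∈ seqSpan K := by
  suffices ∀ g ∈ seqSpan K, f * g ∈ seqSpan K by
    simpa using this 1 (by simpa using seqSpan_hSeq_pow (K := K) 0)
  induction hf using Algebra.adjoin_induction with
  | mem f hf =>
    intro g hg
    rcases hf with (rfl | ⟨m, rfl⟩) | ⟨i, rfl⟩
    · exact hSeq_mul_mem hg
    · exact invSeq_mul_mem m hg
    · refine mem_of_eventually_eq seqSpan_single (zero_mem _) (i + 1) fun k hk => ?_
      have : k ≠ i := by omega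
      simp [this]
  | algebraMap c =>
    intro g hg
    rw [← Algebra.smul_def]
    exact (seqSpan K).smul_mem _ hg
  | add f f' _ _ hf hf' => intro g hg; rw [add_mul]; exact add_mem (hf g hg) (hf' g hg)
  | mul f f' _ _ hf hf' => intro g hg; rw [mul_assoc]; exact hf _ (hf' g hg)

/-- The sequences `f` for which the diagonal operator with entries `f` lies in `𝔻₁`. -/
def diagD1 (K : Type*) [Field K] [CharZero K] : Submodule K (ℕ → K) :=
  (D1 K).comap (diagHom K).toLinearMap

theorem mem_diagD1 {f : ℕ → K} : f ∈ diagD1 K ↔ diag f ∈ D1 K := Iff.rfl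

theorem values_mem_diagD1 (r : Lrat K) : values K r ∈ diagD1 K :=
  mem_diagD1.2 ⟨(r, 0), by simp [op]; rfl⟩

theorem perpSeq_mem_diagD1 (i j : ℕ) (hi : 0 < i) (hj : 0 < j) : perpSeq K i j ∈ diagD1 K := by
  refine mem_diagD1.2 ⟨(0, Finsupp.single (⟨i, hi⟩, ⟨j, hj⟩) 1), ?_⟩
  simp [op, perpOp, opX_opHinv_opD]

theorem values_X : values K ⟨RatFunc.X, X_mem_Lrat K⟩ = hSeq K := by
  funext k
  simp [values, hSeq]

theorem aeval_hSeq_mem_diagD1 (p : K[X]) : aeval (hSeq K) p ∈ diagD1 K := by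
  rw [← values_X, aeval_algHom_apply]
  exact values_mem_diagD1 _

theorem X_add_natCast_inv_mem (i : ℕ) : (RatFunc.X + (i : RatFunc K))⁻¹ ∈ Lrat K :=
  Algebra.subset_adjoin (by simp)

theorem values_X_add_natCast_inv (i : ℕ) :
    values K ⟨(RatFunc.X + (i : RatFunc K))⁻¹, X_add_natCast_inv_mem i⟩ = invSeq K i := by
  have hne : (RatFunc.X + (i : RatFunc K)) ≠ 0 := by
    have : (RatFunc.X + (i : RatFunc K)) = algebraMap K[X] (RatFunc K) (X + C (i : K)) := by simp
    rw [this]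
    exact RatFunc.algebraMap_ne_zero (X_add_C_ne_zero _)
  have h : (⟨RatFunc.X, X_mem_Lrat K⟩ + (i : Lrat K)) *
      ⟨(RatFunc.X + (i : RatFunc K))⁻¹, X_add_natCast_inv_mem i⟩ = 1 :=
    Subtype.ext (mul_inv_cancel₀ hne)
  have h' := congrArg (values K) h
  rw [map_mul, map_add, values_X, map_one, map_natCast] at h'
  funext k
  have hk := congrFun h' k
  simp only [Pi.mul_apply, Pi.add_apply, hSeq, Pi.natCast_apply, Pi.one_apply] at hk
  rw [invSeq, Int.cast_natCast]
  exact eq_inv_of_mul_eq_one_right hk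

/-- The operators `x ^ i ∂ ^ i` and `x ^ (i + 1) H⁻¹ ∂ ^ (i + 1)` have the same diagonal entries
except at `k = i`, where the first has `i!` and the second `0`. -/
theorem single_mem_diagD1 (i : ℕ) : (Pi.single i 1 : ℕ → K) ∈ diagD1 K := by
  have hi : (i.factorial : K) ≠ 0 := Nat.cast_ne_zero.2 i.factorial_ne_zero
  have : (Pi.single i 1 : ℕ → K) = (i.factorial : K)⁻¹ •
      (aeval (hSeq K) (∏ t ∈ Finset.range i, (X - C ((t : K) + 1))) - perpSeq K (i + 1) 1) := by
    funext k
    rw [Pi.smul_apply, Pi.sub_apply, aeval_hSeq_apply, eval_prod_natCast, perpSeq, pow_one,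
      smul_eq_mul]
    rcases lt_trichotomy k i with h | rfl | h
    · rw [Nat.descFactorial_of_lt h, Nat.descFactorial_of_lt (by omega)]
      simp [h.ne]
    · rw [Nat.descFactorial_self, Nat.descFactorial_of_lt (by omega)]
      simp [hi]
    · obtain ⟨m, rfl⟩ := Nat.exists_eq_add_of_lt h
      have e1 : i + m + 1 - (i + 1) = m := by omega
      have e2 : i + m + 1 - i = m + 1 := by omega
      have hm : (m : K) + 1 ≠ 0 := Nat.cast_add_one_ne_zero m
      rw [Nat.descFactorial_succ, e1, e2]
      have : i + m + 1 ≠ i := by omega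
      push_cast
      field_simp
      simp [this]
  rw [this]
  exact (diagD1 K).smul_mem _ (sub_mem (aeval_hSeq_mem_diagD1 _)
    (perpSeq_mem_diagD1 _ _ (by omega) one_pos))

/-- Poles at positive integers must come from `L^⊥`. Since `P = (H - 1) ⋯ (H - i)` does not vanish
at `i + 1`, subtracting a multiple of `P` from `p` makes it divisible by `H - (i + 1)`, which lowers
the order of the pole. -/
theorem aeval_mul_invSeq_mem_diagD1 (i j : ℕ) (p : K[X]) :
    aeval (hSeq K) p * invSeq K (-(i + 1 : ℕ)) ^ j ∈ diagD1 K := by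
  induction j generalizing p with
  | zero => simpa using aeval_hSeq_mem_diagD1 p
  | succ j ih =>
    set P : K[X] := ∏ t ∈ Finset.range i, (X - C ((t : K) + 1)) with hP
    have hPi : P.eval ((i : K) + 1) ≠ 0 := by
      rw [hP, eval_prod_natCast, Nat.descFactorial_self]
      exact Nat.cast_ne_zero.2 i.factorial_ne_zero
    obtain ⟨q, hq⟩ : X - C ((i : K) + 1) ∣
        p - C (p.eval ((i : K) + 1) / P.eval ((i : K) + 1)) * P := by
      rw [dvd_iff_isRoot]
      simp [hPi]
    -- The exponent is `j + 2`, not `j + 1`, because `φ(x ^ (i + 1) H⁻ʲ⁻² ∂ ^ (i + 1))` has the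
    -- factor `H - (i + 1)` in its numerator too; what remains is `P / (H - (i + 1)) ^ (j + 1)`.
    refine mem_of_eventually_eq single_mem_diagD1 (add_mem ((diagD1 K).smul_mem
      (p.eval ((i : K) + 1) / P.eval ((i : K) + 1))
      (perpSeq_mem_diagD1 (i + 1) (j + 2) (by omega) (by omega))) (ih q)) (i + 1) fun k hk => ?_
    simp only [Pi.mul_apply, Pi.add_apply, Pi.smul_apply, Pi.pow_apply, smul_eq_mul,
      aeval_hSeq_apply, invSeq, perpSeq]
    have hp := congrArg (eval ((k : K) + 1)) (sub_eq_iff_eq_add.1 hq)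
    rw [hp]
    simp only [eval_add, eval_mul, eval_sub, eval_C, eval_X]
    have hd : (i.descFactorial i : K) ≠ 0 := by rwa [hP, eval_prod_natCast] at hPi
    rw [hP, eval_prod_natCast, eval_prod_natCast, Nat.descFactorial_succ]
    obtain ⟨m, rfl⟩ := Nat.exists_eq_add_of_le hk
    have e1 : i + 1 + m - (i + 1) = m := by omega
    have e2 : i + 1 + m - i = m + 1 := by omega
    have hm : (m : K) + 1 ≠ 0 := Nat.cast_add_one_ne_zero m
    have e3 : ((i + 1 + m : ℕ) : K) + 1 + ((-((i + 1 : ℕ) : ℤ) : ℤ) : K) = m + 1 := by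
      push_cast; ring
    have e4 : ((i + 1 + m : ℕ) : K) + 1 - (i + 1) = m + 1 := by push_cast; ring
    rw [e1, e2, e3, e4]
    push_cast
    rw [pow_succ, pow_succ _ (j + 1), pow_succ]
    field_simp
    ring

theorem seqAlg_le_diagD1 {f : ℕ → K} (hf : f ∈ seqAlg K) : diag f ∈ D1 K := by
  rw [← mem_diagD1]
  refine (Submodule.span_le.2 ?_ : seqSpan K ≤ diagD1 K) (seqAlg_le_seqSpan hf)
  rintro f ((⟨i, rfl⟩ | ⟨n, rfl⟩) | ⟨⟨m, n⟩, rfl⟩)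
  · exact single_mem_diagD1 i
  · simpa using aeval_hSeq_mem_diagD1 (X ^ n : K[X])
  · change invSeq K m ^ n ∈ diagD1 K
    rcases m with m | m
    · rw [Int.ofNat_eq_natCast, ← values_X_add_natCast_inv, ← map_pow]
      exact values_mem_diagD1 _
    · simpa [Int.negSucc_eq, add_comm] using aeval_mul_invSeq_mem_diagD1 (K := K) m n 1

theorem values_mem_seqAlg (r : Lrat K) : values K r ∈ seqAlg K := by
  obtain ⟨r, hr⟩ := r
  induction hr using Algebra.adjoin_induction with
  | mem r hr =>
    rcases hr with rfl | ⟨i, rfl⟩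
    · exact values_X (K := K) ▸ hSeq_mem
    · exact values_X_add_natCast_inv (K := K) i ▸ invSeq_mem _
  | algebraMap c =>
    have : values K ⟨algebraMap K (RatFunc K) c, Subalgebra.algebraMap_mem _ c⟩ =
      algebraMap K (ℕ → K) c := (values K).commutes c
    exact this ▸ (seqAlg K).algebraMap_mem c
  | add a b ha hb iha ihb =>
    have := (values K).map_add ⟨a, ha⟩ ⟨b, hb⟩
    exact this ▸ add_mem iha ihb
  | mul a b ha hb iha ihb =>
    have := (values K).map_mul ⟨a, ha⟩ ⟨b, hb⟩
    exact this ▸ mul_mem iha ihb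

theorem aeval_hSeq_mem_seqAlg (p : K[X]) : aeval (hSeq K) p ∈ seqAlg K := by
  rw [← values_X, aeval_algHom_apply]
  exact values_mem_seqAlg _

theorem perpSeq_mem_seqAlg (i j : ℕ) : perpSeq K i j ∈ seqAlg K := by
  refine seqAlg_mem_of_eventually_eq (mul_mem (aeval_hSeq_mem_seqAlg
    (∏ t ∈ Finset.range i, (X - C ((t : K) + 1)))) (pow_mem (invSeq_mem (-i)) j)) i fun k hk => ?_
  rw [Pi.mul_apply, aeval_hSeq_apply, eval_prod_natCast, perpSeq, Pi.pow_apply, invSeq]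
  push_cast [hk]
  congr 3
  ring

/-- The diagonal entries of an element of `𝔻₁`. -/
def entries (d : DElt K) : ℕ → K :=
  values K d.1 + d.2.sum fun p c => c • perpSeq K p.1 p.2

theorem op_eq_diag (d : DElt K) : op K d = diag (entries d) := by
  change _ = diagHom K _
  rw [entries, map_add, map_finsuppSum]
  simp only [op, perpOp, LinearMap.coprod_apply, Finsupp.linearCombination_apply, map_smul,
    opX_opHinv_opD]
  rfl

theorem entries_mem_seqAlg (d : DElt K) : entries d ∈ seqAlg K :=
  add_mem (values_mem_seqAlg _) (sum_mem fun _ _ =>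
    (seqAlg K).smul_mem (perpSeq_mem_seqAlg _ _) _)

theorem exists_op_eq_diag {f : ℕ → K} (hf : f ∈ seqAlg K) : ∃ d, op K d = diag f :=
  seqAlg_le_diagD1 hf

end

/-! ### Decompositions of the elements of `𝔸₁`, and reduced ones. -/

section

variable {K : Type*} [Field K]

theorem diag_opX (f : ℕ → K) : diag f * opX K = opX K * diag fun k => f (k + 1) := by
  refine end_ext fun k => ?_
  simp only [Module.End.mul_apply, opX_monomial, diag_monomial]

theorem opX_diag (f : ℕ → K) : opX K * diag f = diag (fun k => f (k - 1)) * opX K := by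
  rw [diag_opX]
  simp

theorem opD_diag (f : ℕ → K) : opD K * diag f = diag (fun k => f (k + 1)) * opD K := by
  refine end_ext fun k => ?_
  simp only [Module.End.mul_apply, opD_monomial, diag_monomial]
  rcases k with _ | k
  · simp
  · simp

theorem opX_mul_opD : opX K * opD K = diag fun k => (k : K) := by
  refine end_ext fun k => ?_
  simp only [Module.End.mul_apply, opD_monomial, diag_monomial, opX_monomial]
  rcases k with _ | k
  · simp
  · simp

theorem diag_opX_pow (f : ℕ → K) (j : ℕ) :
    diag f * opX K ^ j = opX K ^ j * diag fun k => f (k + j) := by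
  refine end_ext fun k => ?_
  simp only [Module.End.mul_apply, opX_pow_monomial, diag_monomial]

theorem opD_mul_opX : opD K * opX K = diag (hSeq K) := opH_eq_diag K

variable [CharZero K]

/-- Composition with `σ` is an algebra endomorphism, so generators suffice. The map `σ` is a shift
only from `N` on, which accommodates the truncated `k - 1`. -/
theorem comp_mem_seqAlg {f : ℕ → K} (hf : f ∈ seqAlg K) (σ : ℕ → ℕ) (s : ℤ) (N : ℕ)
    (hσ : ∀ k, N ≤ k → (σ k : ℤ) = k + s) : (fun k => f (σ k)) ∈ seqAlg K := by
  have hσ' : ∀ k, N ≤ k → (σ k : K) = k + s := fun k hk => by exact_mod_cast hσ k hk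
  let T : (ℕ → K) →ₐ[K] (ℕ → K) := AlgHom.pi fun k => Pi.evalAlgHom K _ (σ k)
  suffices seqAlg K ≤ (seqAlg K).comap T from this hf
  refine Algebra.adjoin_le ?_
  rintro f ((rfl | ⟨m, rfl⟩) | ⟨i, rfl⟩)
  · refine seqAlg_mem_of_eventually_eq (add_mem hSeq_mem
      ((seqAlg K).algebraMap_mem (s : K))) N fun k hk => ?_
    change (σ k : K) + 1 = (k + 1) + s
    rw [hσ' k hk]
    ring
  · refine seqAlg_mem_of_eventually_eq (invSeq_mem (m + s)) N fun k hk => ?_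
    change ((σ k : K) + 1 + m)⁻¹ = ((k : K) + 1 + (m + s : ℤ))⁻¹
    rw [hσ' k hk]
    push_cast
    ring_nf
  · refine seqAlg_mem_of_eventually_eq (zero_mem _) (N + i + 1 + s.natAbs) fun k hk => ?_
    change (Pi.single i 1 : ℕ → K) (σ k) = 0
    have := hσ k (by omega)
    rw [Pi.single_eq_of_ne]
    omega

omit [CharZero K] in
theorem natCast_mem_seqAlg : (fun k : ℕ => (k : K)) ∈ seqAlg K := by
  convert sub_mem (hSeq_mem (K := K)) (one_mem _) using 1
  funext k
  simp [hSeq]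

/-- `(d, d') ↦ ∑_{i ≥ 0} d_i ∂ ^ i + ∑_{j ≥ 1} x ^ j d'_j`. -/
def decompOp (K : Type*) [Field K] [CharZero K] :
    (ℕ →₀ DElt K) × (ℕ+ →₀ DElt K) →ₗ[K] Module.End K K[X] :=
  (Finsupp.lsum K fun i => LinearMap.mulRight K (opD K ^ i) ∘ₗ op K).coprod
    (Finsupp.lsum K fun j : ℕ+ => LinearMap.mulLeft K (opX K ^ (j : ℕ)) ∘ₗ op K)

theorem decompOp_apply (p : (ℕ →₀ DElt K) × (ℕ+ →₀ DElt K)) :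
    decompOp K p = (p.1.sum fun i d => op K d * opD K ^ i) +
      (p.2.sum fun j d => opX K ^ (j : ℕ) * op K d) := rfl

theorem diag_mul_opD_pow_mem {f : ℕ → K} (hf : f ∈ seqAlg K) (i : ℕ) :
    diag f * opD K ^ i ∈ LinearMap.range (decompOp K) := by
  obtain ⟨d, hd⟩ := exists_op_eq_diag hf
  exact ⟨(Finsupp.single i d, 0), by simp [decompOp_apply, hd]⟩

theorem opX_pow_mul_diag_mem {f : ℕ → K} (hf : f ∈ seqAlg K) (j : ℕ) :
    opX K ^ (j + 1) * diag f ∈ LinearMap.range (decompOp K) := by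
  obtain ⟨d, hd⟩ := exists_op_eq_diag hf
  exact ⟨(0, Finsupp.single j.succPNat d), by simp [decompOp_apply, hd]⟩

theorem mul_mem_range_decompOp {a : Module.End K K[X]}
    (hneg : ∀ f ∈ seqAlg K, ∀ i, a * (diag f * opD K ^ i) ∈ LinearMap.range (decompOp K))
    (hpos : ∀ f ∈ seqAlg K, ∀ j, a * (opX K ^ (j + 1) * diag f) ∈ LinearMap.range (decompOp K))
    {b : Module.End K K[X]} (hb : b ∈ LinearMap.range (decompOp K)) :
    a * b ∈ LinearMap.range (decompOp K) := by
  obtain ⟨p, rfl⟩ := hb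
  rw [decompOp_apply, Finsupp.sum, Finsupp.sum, mul_add, Finset.mul_sum, Finset.mul_sum]
  refine add_mem (sum_mem fun i _ => ?_) (sum_mem fun j _ => ?_)
  · rw [op_eq_diag]
    exact hneg _ (entries_mem_seqAlg _) i
  · rw [op_eq_diag]
    have := hpos _ (entries_mem_seqAlg (p.2 j)) ((j : ℕ) - 1)
    rwa [Nat.sub_add_cancel j.pos] at this

/-- The range contains `1` and is stable under left multiplication by each generator: diagonals move
past `x` and `∂` by a shift, and `x ∂`, `∂ x` are diagonal. -/
theorem A1_le_range_decompOp {a : Module.End K K[X]} (ha : a ∈ A1 K) :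
    a ∈ LinearMap.range (decompOp K) := by
  suffices ∀ b ∈ LinearMap.range (decompOp K), a * b ∈ LinearMap.range (decompOp K) by
    have h1 := diag_mul_opD_pow_mem (one_mem (seqAlg K)) 0
    have hd : diag (1 : ℕ → K) = 1 := map_one (diagHom K)
    rw [hd, pow_zero, mul_one] at h1
    simpa using this 1 h1
  induction ha using Algebra.adjoin_induction with
  | mem a ha =>
    intro b hb
    refine mul_mem_range_decompOp (fun f hf i => ?_) (fun f hf j => ?_) hb <;>
      rcases ha with rfl | rfl | rfl
    · rcases i with _ | i
      · simpa using opX_pow_mul_diag_mem hf 0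
      · rw [← mul_assoc, opX_diag, pow_succ', mul_assoc, ← mul_assoc (opX K), opX_mul_opD,
          ← mul_assoc, diag_mul]
        exact diag_mul_opD_pow_mem (mul_mem
          (comp_mem_seqAlg hf (fun k => k - 1) (-1) 1 fun k hk => by omega) natCast_mem_seqAlg) i
    · rw [← mul_assoc, opD_diag, mul_assoc, ← pow_succ']
      exact diag_mul_opD_pow_mem
        (comp_mem_seqAlg hf (fun k => k + 1) 1 0 fun k hk => by omega) _
    · rw [← mul_assoc, opHinv, diag_mul]
      refine diag_mul_opD_pow_mem (mul_mem ?_ hf) i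
      convert invSeq_mem (K := K) 0 using 1
      funext k
      simp [invSeq]
    · rw [← mul_assoc, ← pow_succ']
      exact opX_pow_mul_diag_mem hf _
    · rw [pow_succ', mul_assoc, ← mul_assoc, opD_mul_opX, ← mul_assoc, diag_opX_pow, mul_assoc,
        diag_mul]
      have h := mul_mem
        (comp_mem_seqAlg (hSeq_mem (K := K)) (fun k => k + j) j 0 fun k hk => by omega) hf
      rcases j with _ | j
      · simpa using diag_mul_opD_pow_mem h 0
      · exact opX_pow_mul_diag_mem h j
    · rw [← mul_assoc, opHinv, diag_opX_pow, mul_assoc, diag_mul]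
      refine opX_pow_mul_diag_mem (mul_mem ?_ hf) j
      convert invSeq_mem (K := K) (j + 1 : ℕ) using 1
      funext k
      simp only [invSeq]
      push_cast
      ring_nf
  | algebraMap c =>
    intro b hb
    rw [← Algebra.smul_def]
    exact Submodule.smul_mem _ _ hb
  | add a a' _ _ ha ha' => intro b hb; rw [add_mul]; exact add_mem (ha b hb) (ha' b hb)
  | mul a a' _ _ ha ha' => intro b hb; rw [mul_assoc]; exact ha _ (ha' b hb)

omit [CharZero K] in
theorem mul_opD_pow_mem_F {f : Module.End K K[X]} (hf : f ∈ F K) (n : ℕ) :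
    f * opD K ^ n ∈ F K := by
  induction hf using Submodule.span_induction with
  | mem f hf =>
    obtain ⟨⟨i, j⟩, rfl⟩ := hf
    have : E K i j * opD K ^ n = ((j + n).descFactorial n : K) • E K i (j + n) := by
      refine end_ext fun k => ?_
      simp only [Module.End.mul_apply, opD_pow_monomial, LinearMap.smul_apply, E,
        LinearMap.comp_apply, lcoeff_apply, coeff_monomial, one_mul]
      by_cases h : k = j + n
      · subst h; simp [smul_monomial]
      · rcases lt_or_ge k n with hk | hk
        · simp [Nat.descFactorial_of_lt hk, h]
        · have : k - n ≠ j := by omega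
          simp [h, this]
    rw [this]
    exact Submodule.smul_mem _ _ (Submodule.subset_span ⟨(i, j + n), rfl⟩)
  | zero => simp
  | add f g _ _ hf hg => rw [add_mul]; exact add_mem hf hg
  | smul c f _ hf => rw [smul_mul_assoc]; exact Submodule.smul_mem _ _ hf

theorem sum_opX_mul_op_mem_xD1 (p : ℕ+ →₀ DElt K) :
    (p.sum fun j d => opX K ^ (j : ℕ) * op K d) ∈ xD1 K :=
  sum_mem fun j _ => Submodule.mem_iSup_of_mem j
    (Submodule.mem_map_of_mem (LinearMap.mem_range_self (op K) (p j)))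

/-- In any decomposition, the terms of `a_∂` beyond the last coefficient outside `F` lie in `F` and
can be moved into `a_F`. If every coefficient lies in `F`, then `a` belongs to the second part of
`Ξ`. -/
theorem exists_reduced (a : A1 K) (ha : (a : Module.End K K[X]) ∉ Xi K) :
    ∃ D : Decomp a, D.Reduced := by
  classical
  obtain ⟨⟨neg, pos⟩, h⟩ := A1_le_range_decompOp a.2
  rw [decompOp_apply] at h
  let S := neg.support.filter fun i => op K (neg i) ∉ F K
  by_cases hS : S.Nonempty
  · set n := S.max' hS with hn
    have hnS : n ∈ S := S.max'_mem hS
    obtain ⟨hn1, hn2⟩ := Finset.mem_filter.1 hnS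
    have hmem : ((neg.filter fun i => ¬ i ≤ n).sum fun i d => op K d * opD K ^ i) ∈ F K := by
      refine sum_mem fun i hi => mul_opD_pow_mem_F ?_ i
      rw [Finsupp.support_filter, Finset.mem_filter] at hi
      rw [Finsupp.filter_apply_pos (fun i => ¬ i ≤ n) _ hi.2]
      by_contra hF
      exact hi.2 (S.le_max' i (Finset.mem_filter.2 ⟨hi.1, hF⟩))
    let D : Decomp a :=
      { neg := neg.filter fun i => i ≤ n
        pos := pos
        aF := (neg.filter fun i => ¬ i ≤ n).sum fun i d => op K d * opD K ^ i
        aF_mem := hmem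
        eq_sum := by
          rw [← h, add_right_comm]
          congr 1
          conv_lhs => rw [← Finsupp.filter_add_filter_not neg fun i => i ≤ n]
          exact Finsupp.sum_add_index' (by simp) (by simp [add_mul]) }
    have hdeg : D.deg = n := by
      refine le_antisymm (Finset.sup_le fun i hi => ?_) (Finset.le_sup (f := id) ?_)
      · change i ∈ (neg.filter fun i => i ≤ n).support at hi
        rw [Finsupp.support_filter] at hi
        exact (Finset.mem_filter.1 hi).2
      · change n ∈ (neg.filter fun i => i ≤ n).support
        rw [Finsupp.support_filter]
        exact Finset.mem_filter.2 ⟨hn1, le_rfl⟩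
    refine ⟨D, ?_⟩
    rw [Decomp.Reduced, Decomp.lead, hdeg]
    change op K (neg.filter (fun i => i ≤ n) n) ∉ F K
    rwa [Finsupp.filter_apply_pos (fun i => i ≤ n) _ le_rfl]
  · refine absurd (Or.inr ?_) ha
    change (a : Module.End K K[X]) ∈ xD1 K ⊔ F K
    rw [← h, add_comm]
    refine add_mem (Submodule.mem_sup_left (sum_opX_mul_op_mem_xD1 _))
      (Submodule.mem_sup_right (sum_mem fun i hi => mul_opD_pow_mem_F ?_ i))
    by_contra hF
    exact hS ⟨i, Finset.mem_filter.2 ⟨hi, hF⟩⟩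

end

/-! ### Rational functions, their values along the diagonal, and `μ`. -/

section

variable {K : Type*} [Field K]

theorem tau_eq (i : ℕ) (r : RatFunc K) :
    tau i r = algebraMap K[X] (RatFunc K) (r.num.comp (X + C (i : K))) /
      algebraMap K[X] (RatFunc K) (r.denom.comp (X + C (i : K))) := by
  have h (p : K[X]) : p.eval₂ RatFunc.C (RatFunc.X + (i : RatFunc K)) =
      algebraMap K[X] (RatFunc K) (p.comp (X + C (i : K))) := by
    have hC : (algebraMap K[X] (RatFunc K)).comp C = RatFunc.C :=
      RingHom.ext fun c => RatFunc.algebraMap_C c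
    rw [comp, hom_eval₂, hC]
    simp
  rw [tau, RatFunc.eval, h, h]

/-- Cross-multiplied form of `(τ ^ i r)(m) = r(m + i)`, valid at poles as well. It transfers roots
between the reduced numerators of `r` and `τ ^ i r`. -/
theorem num_tau_eval (i m : ℕ) (r : RatFunc K) :
    (tau i r).num.eval (m : K) * r.denom.eval ((m : K) + i) =
      r.num.eval ((m : K) + i) * (tau i r).denom.eval (m : K) := by
  have hne : r.denom.comp (X + C (i : K)) ≠ 0 := by
    rw [Ne, comp_X_add_C_eq_zero_iff]
    exact r.denom_ne_zero
  have h := congrArg (eval (m : K)) ((RatFunc.num_mul_eq_mul_denom_iff hne).2 (tau_eq i r))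
  simpa using h

theorem eval_ne_zero_of_isCoprime {p q : K[X]} (h : IsCoprime p q) {x : K} (hp : p.eval x = 0) :
    q.eval x ≠ 0 := by
  obtain ⟨u, v, huv⟩ := h
  intro hq
  simpa [hp, hq] using congrArg (eval x) huv

/-- From `N` on, the sequence `f` takes the values of the rational function `r`, and `r` has no
poles there. -/
def HasValuesFrom (r : RatFunc K) (f : ℕ → K) (N : ℕ) : Prop :=
  ∃ p q : K[X], r = algebraMap K[X] (RatFunc K) p / algebraMap K[X] (RatFunc K) q ∧
    ∀ k, N ≤ k → q.eval ((k : K) + 1) ≠ 0 ∧ f k * q.eval ((k : K) + 1) = p.eval ((k : K) + 1)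

namespace HasValuesFrom

theorem denom_ne_zero {q : K[X]} {N : ℕ}
    (h : ∀ k : ℕ, N ≤ k → q.eval ((k : K) + 1) ≠ 0) : q ≠ 0 := by
  rintro rfl
  exact h N le_rfl (by simp)

theorem zero (N : ℕ) : HasValuesFrom (0 : RatFunc K) 0 N := ⟨0, 1, by simp, by simp⟩

theorem add {r s : RatFunc K} {f g : ℕ → K} {N : ℕ} (hr : HasValuesFrom r f N)
    (hs : HasValuesFrom s g N) : HasValuesFrom (r + s) (f + g) N := by
  obtain ⟨p, q, rfl, h⟩ := hr
  obtain ⟨p', q', rfl, h'⟩ := hs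
  have hq := RatFunc.algebraMap_ne_zero (denom_ne_zero fun k hk => (h k hk).1)
  have hq' := RatFunc.algebraMap_ne_zero (denom_ne_zero fun k hk => (h' k hk).1)
  refine ⟨p * q' + q * p', q * q', ?_, fun k hk => ⟨?_, ?_⟩⟩
  · rw [div_add_div _ _ hq hq']
    simp
  · rw [eval_mul]
    exact mul_ne_zero (h k hk).1 (h' k hk).1
  · simp only [eval_add, eval_mul, Pi.add_apply]
    rw [← (h k hk).2, ← (h' k hk).2]
    ring

theorem smul (c : K) {r : RatFunc K} {f : ℕ → K} {N : ℕ} (hr : HasValuesFrom r f N) :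
    HasValuesFrom (c • r) (c • f) N := by
  obtain ⟨p, q, rfl, h⟩ := hr
  refine ⟨C c * p, q, ?_, fun k hk => ⟨(h k hk).1, ?_⟩⟩
  · rw [map_mul, mul_div_assoc, RatFunc.algebraMap_C, RatFunc.smul_eq_C_mul]
  · simp only [Pi.smul_apply, smul_eq_mul, eval_mul, eval_C]
    rw [← (h k hk).2, mul_assoc]

theorem sum {ι : Type*} (s : Finset ι) {r : ι → RatFunc K} {f : ι → ℕ → K} {N : ℕ}
    (h : ∀ i ∈ s, HasValuesFrom (r i) (f i) N) :
    HasValuesFrom (∑ i ∈ s, r i) (∑ i ∈ s, f i) N := by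
  classical
  induction s using Finset.induction_on with
  | empty => simpa using zero N
  | insert i s hi ih =>
    rw [Finset.sum_insert hi, Finset.sum_insert hi]
    exact (h i (by simp)).add (ih fun j hj => h j (by simp [hj]))

theorem num_eval_eq_zero {r : RatFunc K} {f : ℕ → K} {N : ℕ} (h : HasValuesFrom r f N)
    {k : ℕ} (hk : N ≤ k) (hf : f k = 0) : r.num.eval ((k : K) + 1) = 0 := by
  obtain ⟨p, q, hr, h⟩ := h
  have hq := denom_ne_zero fun k hk => (h k hk).1
  have e := congrArg (eval ((k : K) + 1)) ((RatFunc.num_mul_eq_mul_denom_iff hq).2 hr)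
  rw [eval_mul, eval_mul, ← (h k hk).2, hf, zero_mul, zero_mul] at e
  exact (mul_eq_zero.1 e).resolve_right (h k hk).1

end HasValuesFrom

variable [CharZero K]

theorem hasValuesFrom_values (r : Lrat K) (N : ℕ) :
    HasValuesFrom (r : RatFunc K) (values K r) N := by
  refine ⟨_, _, (RatFunc.num_div_denom _).symm, fun k _ => ?_⟩
  have h := eval_denom_ne_zero r k
  refine ⟨h, ?_⟩
  exact div_mul_cancel₀ _ h

/-- From `k = i` on the subtraction `k - i` is not truncated and `H - i` takes the nonzero value `k
+ 1 - i`. This is why `μ` is required to be at least `δ`. -/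
theorem hasValuesFrom_perpSeq (i j N : ℕ) (hN : i ≤ N) :
    HasValuesFrom ((∏ t ∈ Finset.Icc 1 i, (RatFunc.X - (t : RatFunc K))) /
      (RatFunc.X - (i : RatFunc K)) ^ j) (perpSeq K i j) N := by
  refine ⟨∏ t ∈ Finset.range i, (X - C ((t : K) + 1)), (X - C (i : K)) ^ j, ?_, fun k hk => ?_⟩
  · congr 1
    · clear hN
      induction i with
      | zero => simp
      | succ i ih =>
        rw [Finset.prod_Icc_succ_top (by omega), Finset.prod_range_succ, map_mul, ih]
        simp
    · simp
  · obtain ⟨m, rfl⟩ := Nat.exists_eq_add_of_le (hN.trans hk)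
    have hm : (m : K) + 1 ≠ 0 := Nat.cast_add_one_ne_zero m
    have e : ((i + m : ℕ) : K) + 1 - i = m + 1 := by push_cast; ring
    rw [eval_prod_natCast, perpSeq, Nat.add_sub_cancel_left]
    simp only [eval_pow, eval_sub, eval_X, eval_C, e]
    refine ⟨pow_ne_zero _ hm, ?_⟩
    rw [mul_assoc, ← mul_pow, inv_mul_cancel₀ hm, one_pow, mul_one]

theorem hasValuesFrom_entries (d : DElt K) :
    HasValuesFrom ((d.1 : RatFunc K) + phi K d.2) (entries d) (delta d.2) := by
  refine (hasValuesFrom_values d.1 _).add ?_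
  rw [phi, Finsupp.linearCombination_apply]
  exact HasValuesFrom.sum _ fun p hp => (hasValuesFrom_perpSeq _ _ _
    (Finset.le_sup (f := fun p : ℕ+ × ℕ+ => (p.1 : ℕ)) hp)).smul _

theorem entries_ne_zero {d : DElt K} {i k : ℕ} (hi : i ∈ muSet d) (hk : i ≤ k) :
    entries d k ≠ 0 := by
  intro h0
  have h := (hasValuesFrom_entries d).num_eval_eq_zero (hi.1.trans hk) h0
  have e : ((k + 1 - i : ℕ) : K) + i = k + 1 := by
    rw [← Nat.cast_add, Nat.sub_add_cancel (by omega)]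
    push_cast
    rfl
  -- The entry at `k` is the value of the function at `H = k + 1`, hence that of its `i`-th shift at
  -- `k + 1 - i ≥ 1`.
  have h2 := num_tau_eval i (k + 1 - i) ((d.1 : RatFunc K) + phi K d.2)
  rw [e, h, zero_mul] at h2
  exact hi.2 (k + 1 - i) (by omega) ((mul_eq_zero.1 h2).resolve_right
    (eval_ne_zero_of_isCoprime (RatFunc.isCoprime_num_denom _) h))

omit [CharZero K] in
theorem diag_mem_F {f : ℕ → K} {N : ℕ} (h : ∀ k, N ≤ k → f k = 0) : diag f ∈ F K := by
  rw [eq_sum_single h]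
  change diagHom K _ ∈ _
  rw [map_sum]
  refine sum_mem fun i _ => ?_
  rw [map_smul]
  refine Submodule.smul_mem _ _ (Submodule.subset_span ⟨(i, i), end_ext fun k => ?_⟩)
  change _ = diag _ _
  rw [diag_monomial]
  by_cases hk : k = i
  · subst hk; simp [E]
  · simp [E, hk, coeff_monomial]

/-- If `l + φ(l^⊥)` were zero, the diagonal entries would vanish from `δ` on and `d` would lie in
`F`. A nonzero rational function has finitely many roots, and a shift beyond all the natural ones
leaves none in `{1, 2, …}`. -/
theorem muSet_nonempty {d : DElt K} (hd : op K d ∉ F K) : (muSet d).Nonempty := by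
  classical
  set r := (d.1 : RatFunc K) + phi K d.2 with hr
  have hr0 : r ≠ 0 := by
    intro h0
    obtain ⟨p, q, hpq, h⟩ := hasValuesFrom_entries d
    have hq := HasValuesFrom.denom_ne_zero fun k hk => (h k hk).1
    have hp : p = 0 := by
      rw [← hr, h0, eq_comm, div_eq_zero_iff] at hpq
      have := hpq.resolve_right (RatFunc.algebraMap_ne_zero hq)
      simpa using this
    refine hd ?_
    rw [op_eq_diag]
    refine diag_mem_F (N := delta d.2) fun k hk => ?_
    have := (h k hk).2
    rw [hp, eval_zero] at this
    exact (mul_eq_zero.1 this).resolve_right (h k hk).1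
  have hfin : {n : ℕ | r.num.eval (n : K) = 0}.Finite := by
    refine Set.Finite.of_finite_image ?_ (Nat.cast_injective (R := K)).injOn
    refine (r.num.roots.toFinset.finite_toSet).subset ?_
    rintro _ ⟨n, hn, rfl⟩
    simpa [RatFunc.num_ne_zero hr0] using hn
  obtain ⟨B, hB⟩ := hfin.bddAbove
  refine ⟨max (delta d.2) B, le_max_left _ _, fun m hm h0 => ?_⟩
  have h := num_tau_eval (max (delta d.2) B) m r
  have h0' : (tau (max (delta d.2) B) r).num.eval (m : K) = 0 := h0
  rw [h0', zero_mul] at h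
  have h1 := (mul_eq_zero.1 h.symm).resolve_right
    (eval_ne_zero_of_isCoprime (RatFunc.isCoprime_num_denom _) h0')
  have := hB (a := m + max (delta d.2) B) (by simpa using h1)
  have := le_max_right (delta d.2) B
  omega

end

/-! ### Matrix entries and the right action. -/

section

variable {K : Type*} [Field K]

/-- The matrix entry `a_{kl}`, the coefficient of `x ^ k` in `a x ^ l`, as a function of `a`. -/
def entry (K : Type*) [Field K] (k l : ℕ) : Module.End K K[X] →ₗ[K] K :=
  lcoeff K k ∘ₗ LinearMap.applyₗ (monomial l (1 : K))

theorem entry_apply (k l : ℕ) (a : Module.End K K[X]) :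
    entry K k l a = (a (monomial l 1)).coeff k := rfl

theorem entry_diag_mul_opD_pow (f : ℕ → K) (i k l : ℕ) :
    entry K k l (diag f * opD K ^ i) = if l = k + i then f k * l.descFactorial i else 0 := by
  rw [entry_apply, Module.End.mul_apply, opD_pow_monomial, diag_monomial, coeff_monomial]
  rcases lt_or_ge l i with h | h
  · have : l ≠ k + i := by omega
    simp [Nat.descFactorial_of_lt h, this]
  · by_cases hl : l = k + i
    · subst hl; simp
    · rw [if_neg (by omega), if_neg hl]

theorem entry_opX_pow_mul_diag (f : ℕ → K) (j k l : ℕ) :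
    entry K k l (opX K ^ j * diag f) = if l + j = k then f l else 0 := by
  rw [entry_apply, Module.End.mul_apply, diag_monomial, opX_pow_monomial, coeff_monomial, mul_one]

theorem entry_of_mem_Fle {f : Module.End K K[X]} {n : ℕ} (hf : f ∈ Fle K n) {k l : ℕ}
    (h : n < k ∨ n < l) : entry K k l f = 0 := by
  suffices Fle K n ≤ LinearMap.ker (entry K k l) from this hf
  refine Submodule.span_le.2 ?_
  rintro _ ⟨i, j, hi, hj, rfl⟩
  change entry K k l _ = 0
  rw [entry_apply, E, LinearMap.comp_apply, lcoeff_apply, coeff_monomial, coeff_monomial]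
  split_ifs <;> first | rfl | omega

theorem Fle_mono {m n : ℕ} (h : m ≤ n) : Fle K m ≤ Fle K n :=
  Submodule.span_mono fun _ ⟨i, j, hi, hj, e⟩ => ⟨i, j, hi.trans h, hj.trans h, e⟩

theorem exists_mem_Fle {f : Module.End K K[X]} (hf : f ∈ F K) : ∃ n, f ∈ Fle K n := by
  have h : F K ≤ ⨆ n, Fle K n := by
    refine Submodule.span_le.2 ?_
    rintro _ ⟨⟨i, j⟩, rfl⟩
    exact Submodule.mem_iSup_of_mem (max i j)
      (Submodule.subset_span ⟨i, j, le_max_left _ _, le_max_right _ _, rfl⟩)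
  exact (Submodule.mem_iSup_of_directed _
    (Monotone.directed_le fun _ _ => Fle_mono)).1 (h hf)

theorem mem_Fle_of_size_le {f : Module.End K K[X]} (hf : f ∈ F K) {n : ℕ}
    (h : size f ≤ (n : ℤ)) : f ∈ Fle K n := by
  rw [size] at h
  split_ifs at h with h0
  · rw [h0]; exact zero_mem _
  · exact Fle_mono (by exact_mod_cast h) (Nat.sInf_mem (s := {n | f ∈ Fle K n}) (exists_mem_Fle hf))

/-- The operator `1 - x H⁻¹ ∂` is the projection onto constants `E₀₀`, and `x ^ i E₀₀ ∂ ^ j = j!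
E_{ij}`. -/
theorem E_mem_A1 [CharZero K] (i j : ℕ) : E K i j ∈ A1 K := by
  have h0 : E K 0 0 = 1 - opX K * opHinv K * opD K := by
    refine end_ext fun k => ?_
    simp only [LinearMap.sub_apply, Module.End.mul_apply, Module.End.one_apply, opD_monomial,
      opHinv, diag_monomial, opX_monomial, E, LinearMap.comp_apply, lcoeff_apply, coeff_monomial]
    rcases k with _ | k
    · simp
    · have : (k : K) + 1 ≠ 0 := Nat.cast_add_one_ne_zero k
      simp [this]
  have h : E K i j = (j.factorial : K)⁻¹ • (opX K ^ i * E K 0 0 * opD K ^ j) := by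
    have hj : (j.factorial : K) ≠ 0 := Nat.cast_ne_zero.2 j.factorial_ne_zero
    refine end_ext fun k => ?_
    simp only [LinearMap.smul_apply, Module.End.mul_apply, opD_pow_monomial, E,
      LinearMap.comp_apply, lcoeff_apply, coeff_monomial, opX_pow_monomial]
    by_cases hk : k = j
    · subst hk
      simp [smul_monomial, Nat.descFactorial_self, hj]
    · rcases lt_or_ge k j with hlt | hge
      · simp [Nat.descFactorial_of_lt hlt, hk]
      · have : k - j ≠ 0 := by omega
        simp [hk, this]
  rw [h, h0]
  exact (A1 K).smul_mem (mul_mem (mul_mem (pow_mem (opX_mem K) i) (sub_mem (one_mem _)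
    (mul_mem (mul_mem (opX_mem K) (opHinv_mem K)) (opD_mem K)))) (pow_mem (opD_mem K) j)) _

variable [CharZero K]

theorem Decomp.aF_mem_Fle {a : A1 K} (D : Decomp a) : D.aF ∈ Fle K D.nu :=
  mem_Fle_of_size_le D.aF_mem ((le_max_left _ _).trans (Int.self_le_toNat _))

theorem Decomp.mu_le_nu {a : A1 K} (D : Decomp a) : mu D.lead ≤ D.nu := by
  have : (mu D.lead : ℤ) ≤ D.nu := (le_max_right _ _).trans (Int.self_le_toNat _)
  exact_mod_cast this

/-- In the column `l > ν` nothing comes from `a_F`; on or beyond the superdiagonal `l = k + deg`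
only the leading term of `a_∂` can contribute. -/
theorem Decomp.entry_eq {a : A1 K} (D : Decomp a) {k l : ℕ} (hl : D.nu < l)
    (hkl : k + D.deg ≤ l) : entry K k l (a : Module.End K K[X]) =
      if l = k + D.deg then entries D.lead k * l.descFactorial D.deg else 0 := by
  rw [D.eq_sum, map_add, map_add, entry_of_mem_Fle D.aF_mem_Fle (Or.inr hl), add_zero,
    Finsupp.sum, Finsupp.sum, map_sum, map_sum]
  rw [Finset.sum_eq_zero (s := D.pos.support), add_zero]
  · simp only [op_eq_diag, entry_diag_mul_opD_pow]
    rw [Finset.sum_eq_single D.deg]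
    · rfl
    · intro i hi hne
      have : i ≤ D.deg := Finset.le_sup (f := id) hi
      rw [if_neg (by omega)]
    · intro h
      rw [Finsupp.notMem_support_iff.1 h]
      simp [entries]
  · intro j _
    have := j.pos
    rw [op_eq_diag, entry_opX_pow_mul_diag, if_neg (by omega)]

theorem factorial_mul_coeff_rightAct (a : A1 K) (k l : ℕ) :
    (l.factorial : K) * (rightAct a (monomial k 1)).coeff l =
      k.factorial * entry K k l (a : Module.End K K[X]) := by
  have h := isAdj_theta a (monomial k 1) (monomial l 1)
  rw [form_monomial, form_symm, form_monomial, one_mul, one_mul] at h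
  exact h.symm

theorem coeff_rightAct_eq_zero_iff (a : A1 K) (k l : ℕ) :
    (rightAct a (monomial k 1)).coeff l = 0 ↔ entry K k l (a : Module.End K K[X]) = 0 := by
  have hk : (k.factorial : K) ≠ 0 := Nat.cast_ne_zero.2 k.factorial_ne_zero
  have hl : (l.factorial : K) ≠ 0 := Nat.cast_ne_zero.2 l.factorial_ne_zero
  rw [← mul_eq_zero_iff_left hl, factorial_mul_coeff_rightAct, mul_eq_zero_iff_left hk]

omit [CharZero K] in
theorem coeff_map_eq_sum (T : K[X] →ₗ[K] K[X]) (p : K[X]) (l : ℕ) :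
    (T p).coeff l = ∑ k ∈ Finset.range (p.natDegree + 1),
      p.coeff k * (T (monomial k 1)).coeff l := by
  conv_lhs => rw [p.as_sum_range, map_sum, finsetSum_coeff]
  refine Finset.sum_congr rfl fun k _ => ?_
  rw [← mul_one (p.coeff k), ← smul_eq_mul, ← smul_monomial, map_smul, coeff_smul, smul_eq_mul,
    smul_eq_mul, mul_one]

omit [CharZero K] in
theorem mapsTo_degreeLE (T : K[X] →ₗ[K] K[X]) (N M : ℕ)
    (h : ∀ k l, k ≤ N → M < l → (T (monomial k 1)).coeff l = 0) :
    Set.MapsTo T (degreeLE K (N : WithBot ℕ) : Set K[X]) (degreeLE K (M : WithBot ℕ)) := by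
  intro p hp
  have hp' := natDegree_le_iff_degree_le.2 (mem_degreeLE.1 hp)
  refine mem_degreeLE.2 ((degree_le_iff_coeff_zero _ _).2 fun l hl => ?_)
  rw [coeff_map_eq_sum]
  refine Finset.sum_eq_zero fun k hk => ?_
  have := Finset.mem_range.1 hk
  rw [h k l (by omega) (by exact_mod_cast hl), mul_zero]

omit [CharZero K] in
-- If `p` has degree above `N`, the coefficient of `T p` in degree `deg p + n` comes from the
-- leading monomial of `p` alone, so it is nonzero.
theorem injective_of_injOn_degreeLE (T : K[X] →ₗ[K] K[X]) (N n : ℕ)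
    (h0 : ∀ k l, N + n < l → k + n < l → (T (monomial k 1)).coeff l = 0)
    (h1 : ∀ k, N < k → (T (monomial k 1)).coeff (k + n) ≠ 0)
    (hT : Set.InjOn T (degreeLE K (N : WithBot ℕ) : Set K[X])) : Function.Injective T := by
  rw [injective_iff_map_eq_zero]
  intro p hp
  by_cases hN : p.natDegree ≤ N
  · exact hT (mem_degreeLE.2 (natDegree_le_iff_degree_le.1 hN)) (zero_mem (degreeLE K N))
      (by rw [hp, map_zero])
  · rw [not_le] at hN
    have h := coeff_map_eq_sum T p (p.natDegree + n)
    rw [hp, coeff_zero, Finset.sum_range_succ, Finset.sum_eq_zero, zero_add] at h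
    · exact leadingCoeff_eq_zero.1 ((mul_eq_zero.1 h.symm).resolve_right (h1 _ hN))
    · intro k hk
      have := Finset.mem_range.1 hk
      rw [h0 _ _ (by omega) (by omega), mul_zero]

theorem Decomp.coeff_rightAct_eq_zero {a : A1 K} (D : Decomp a) (k l : ℕ)
    (hl : D.nu + D.deg < l) (hkl : k + D.deg < l) :
    (rightAct a (monomial k 1)).coeff l = 0 := by
  rw [coeff_rightAct_eq_zero_iff, D.entry_eq (by omega) hkl.le, if_neg hkl.ne']

theorem Decomp.mapsTo_rightAct {a : A1 K} (D : Decomp a) :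
    Set.MapsTo (rightAct a) (degreeLE K (D.nu : WithBot ℕ) : Set K[X])
      (degreeLE K ((D.nu + D.deg : ℕ) : WithBot ℕ) : Set K[X]) :=
  mapsTo_degreeLE _ _ _ fun k l hk hl => D.coeff_rightAct_eq_zero k l hl (by omega)

theorem Decomp.Reduced.injective_rightAct_iff {a : A1 K} {D : Decomp a} (hD : D.Reduced) :
    Function.Injective (rightAct a) ↔
      Set.InjOn (rightAct a) (degreeLE K (D.nu : WithBot ℕ) : Set K[X]) := by
  refine ⟨fun h => h.injOn, injective_of_injOn_degreeLE _ _ D.deg D.coeff_rightAct_eq_zero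
    fun k hk => ?_⟩
  rw [Ne, coeff_rightAct_eq_zero_iff, D.entry_eq (by omega) le_rfl, if_pos rfl]
  refine mul_ne_zero (entries_ne_zero (Nat.sInf_mem (muSet_nonempty hD))
    (D.mu_le_nu.trans hk.le)) ?_
  rw [Nat.cast_ne_zero, Ne, Nat.descFactorial_eq_zero_iff_lt]
  omega

/-! ### Regularity in terms of the right module, and the role of `θ`. -/

theorem mem_leftRegular_iff (a : A1 K) :
    a ∈ leftRegular (A1 K) ↔ Function.Injective (rightAct a) := by
  constructor
  · intro ha
    rw [injective_iff_map_eq_zero]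
    intro p hp
    have hsum : (monomial 0 : K →ₗ[K] K[X]) ∘ₗ form K p =
        ∑ k ∈ Finset.range (p.natDegree + 1), (p.coeff k * k.factorial) • E K 0 k := by
      refine LinearMap.ext fun q => ?_
      conv_lhs => rw [p.as_sum_range]
      rw [LinearMap.comp_apply, map_sum, LinearMap.sum_apply, map_sum, LinearMap.sum_apply]
      refine Finset.sum_congr rfl fun k _ => ?_
      rw [form_monomial, LinearMap.smul_apply, E, LinearMap.comp_apply, lcoeff_apply,
        smul_monomial, smul_eq_mul, mul_assoc]
    -- The functional `(p, ·)` viewed as an operator with values in the constants. By adjunction `b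
    -- a` is the operator attached in the same way to `p a = 0`.
    let b : A1 K := ⟨(monomial 0 : K →ₗ[K] K[X]) ∘ₗ form K p, by
      rw [hsum]
      exact sum_mem fun k _ => (A1 K).smul_mem (E_mem_A1 0 k) _⟩
    have hba : b * a = 0 * a := by
      refine Subtype.ext (LinearMap.ext fun q => ?_)
      change monomial 0 (form K p ((a : Module.End K K[X]) q)) = _
      have hp' : (theta K a : Module.End K K[X]) p = 0 := hp
      rw [isAdj_theta a p q, hp']
      simp
    have hb : b = 0 := ha hba
    refine form_nondegenerate fun q => ?_
    have hq : (b : Module.End K K[X]) q = 0 := by rw [hb]; rfl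
    have hq' : monomial 0 (form K p q) = 0 := hq
    rw [monomial_eq_zero_iff] at hq'
    rw [hq']
    simp
  · intro ha
    change Function.Injective fun b : A1 K => b * a
    intro b b' h
    have h' : theta K a * theta K b = theta K a * theta K b' := by
      rw [← theta_mul, ← theta_mul]
      exact congrArg (theta K) h
    have : theta K b = theta K b' := by
      refine Subtype.ext (LinearMap.ext fun q => ha ?_)
      exact congrArg (fun c : A1 K => (c : Module.End K K[X]) q) h'
    rw [← theta_theta b, this, theta_theta]

theorem rightRegular_eq_image_theta :
    rightRegular (A1 K) = theta K '' leftRegular (A1 K) := by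
  have hinj : Function.Injective (theta K) := fun a b h => by
    rw [← theta_theta a, h, theta_theta]
  ext a
  constructor
  · intro ha
    refine ⟨theta K a, fun b c h => ?_, theta_theta a⟩
    have h' := congrArg (theta K) h
    simp only [theta_mul, theta_theta] at h'
    exact hinj (ha h')
  · rintro ⟨a, ha, rfl⟩ b c h
    have h' := congrArg (theta K) h
    simp only [theta_mul, theta_theta] at h'
    exact hinj (ha h')

/-! ### Elements of `Ξ`. -/

theorem entry_of_mem_xD1 {a : Module.End K K[X]} (ha : a ∈ xD1 K) {k l : ℕ} (h : k ≤ l) :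
    entry K k l a = 0 := by
  suffices xD1 K ≤ LinearMap.ker (entry K k l) from this ha
  refine iSup_le fun j => ?_
  rintro _ ⟨_, ⟨d, rfl⟩, rfl⟩
  have := j.pos
  rw [LinearMap.mem_ker, LinearMap.mulLeft_apply, op_eq_diag, entry_opX_pow_mul_diag,
    if_neg (by omega)]

theorem entry_zero_of_mem_Lperp {a : Module.End K K[X]}
    (ha : a ∈ (⨆ i : ℕ, (Lperp K).map (LinearMap.mulRight K (opD K ^ i))) ⊔ xD1 K) (l : ℕ) :
    entry K 0 l a = 0 := by
  suffices (⨆ i : ℕ, (Lperp K).map (LinearMap.mulRight K (opD K ^ i))) ⊔ xD1 K ≤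
    LinearMap.ker (entry K 0 l) from this ha
  refine sup_le (iSup_le fun i => ?_) fun a ha => entry_of_mem_xD1 ha (Nat.zero_le l)
  rintro _ ⟨_, ⟨c, rfl⟩, rfl⟩
  have hc : perpOp K c = op K (0, c) := by simp [op]
  rw [LinearMap.mem_ker, LinearMap.mulRight_apply, hc, op_eq_diag, entry_diag_mul_opD_pow]
  have h0 : entries ((0, c) : DElt K) 0 = 0 := by
    rw [entries, map_zero, zero_add, Finsupp.sum, Finset.sum_apply]
    refine Finset.sum_eq_zero fun p _ => ?_
    rw [Pi.smul_apply, perpSeq, Nat.descFactorial_of_lt p.1.pos]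
    simp
  simp [h0]

/-- Elements of the first part kill `1 ∈ K[∂]`. For `g + f` with `g` strictly lower triangular and
`f ∈ F` of size at most `s`, the degrees up to `s + 1` are squeezed into degrees up to `s`, against
the dimension count. -/
theorem not_injective_of_mem_Xi {a : A1 K} (ha : (a : Module.End K K[X]) ∈ Xi K) :
    ¬ Function.Injective (rightAct a) := by
  intro hinj
  rcases ha with ha | ha
  · have h : rightAct a (monomial 0 1) = 0 := by
      ext l
      rw [(coeff_rightAct_eq_zero_iff a 0 l).2 (entry_zero_of_mem_Lperp ha l), coeff_zero]
    rw [← map_zero (rightAct a)] at h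
    exact one_ne_zero ((monomial_eq_zero_iff _ _).1 (hinj h))
  · obtain ⟨g, hg, f, hf, hgf⟩ := Submodule.mem_sup.1 ha
    obtain ⟨s, hs⟩ := exists_mem_Fle hf
    have hmaps := mapsTo_degreeLE (rightAct a) (s + 1) s fun k l hk hl => by
      rw [coeff_rightAct_eq_zero_iff, ← hgf, map_add, entry_of_mem_xD1 hg (by omega),
        entry_of_mem_Fle hs (Or.inr hl), add_zero]
    have hLT (n : ℕ) : degreeLE K (n : WithBot ℕ) = degreeLT K (n + 1) := by
      ext p
      rw [mem_degreeLE, mem_degreeLT, degree_le_iff_coeff_zero, degree_lt_iff_coeff_zero]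
      simp only [Nat.cast_lt, Nat.succ_le_iff]
    rw [hLT, hLT] at hmaps
    let T : degreeLT K (s + 1 + 1) →ₗ[K] degreeLT K (s + 1) :=
      (rightAct a).restrict hmaps
    have hT : Function.Injective T := fun p q h => Subtype.ext (hinj (congrArg Subtype.val h))
    -- In coordinates this is an injection from `K ^ (s + 2)` to `K ^ (s + 1)`.
    let T' := (degreeLTEquiv K (s + 1)).toLinearMap ∘ₗ T ∘ₗ
      (degreeLTEquiv K (s + 1 + 1)).symm.toLinearMap
    have hT' : Function.Injective T' :=
      (degreeLTEquiv K (s + 1)).injective.comp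
        (hT.comp (degreeLTEquiv K (s + 1 + 1)).symm.injective)
    have := LinearMap.finrank_le_finrank_of_injective hT'
    simp at this

end

end

end Jacobian

theorem mainTheorem10 (K : Type*) [Field K] [CharZero K] :
    -- `ν` is defined for every element outside `Ξ`
    (∀ a : Jacobian.A1 K, (a : Module.End K K[X]) ∉ Jacobian.Xi K →
      ∃ D : Jacobian.Decomp a, D.Reduced) ∧
    (∀ d : Jacobian.DElt K, Jacobian.op K d ∉ Jacobian.F K → (Jacobian.muSet d).Nonempty) ∧
    -- right multiplication by `a` maps the polynomials in `∂` of degree at most `ν(a)`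
    -- to polynomials of degree at most `ν(a) + deg_∂ (a_∂)`
    (∀ a : Jacobian.A1 K, (a : Module.End K K[X]) ∉ Jacobian.Xi K →
      ∀ D : Jacobian.Decomp a, D.Reduced →
        Set.MapsTo (Jacobian.rightAct a) (degreeLE K (D.nu : WithBot ℕ) : Set K[X])
          (degreeLE K ((D.nu + D.deg : ℕ) : WithBot ℕ) : Set K[X])) ∧
    -- the left regular elements
    (∀ D : ∀ a : Jacobian.A1 K, (a : Module.End K K[X]) ∉ Jacobian.Xi K →
        {D : Jacobian.Decomp a // D.Reduced},
      Jacobian.leftRegular (Jacobian.A1 K) =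
        {a : Jacobian.A1 K | ∃ h : (a : Module.End K K[X]) ∉ Jacobian.Xi K,
          Set.InjOn (Jacobian.rightAct a)
            (degreeLE K ((D a h).1.nu : WithBot ℕ) : Set K[X])}) ∧
    -- the right regular elements
    Jacobian.rightRegular (Jacobian.A1 K) =
      Jacobian.theta K '' Jacobian.leftRegular (Jacobian.A1 K) := by
  refine ⟨Jacobian.exists_reduced, fun d => Jacobian.muSet_nonempty,
    fun a _ D _ => D.mapsTo_rightAct, fun D => ?_, Jacobian.rightRegular_eq_image_theta⟩
  ext a
  rw [Jacobian.mem_leftRegular_iff]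
  constructor
  · intro h
    have ha : (a : Module.End K K[X]) ∉ Jacobian.Xi K := fun ha =>
      Jacobian.not_injective_of_mem_Xi ha h
    exact ⟨ha, (D a ha).2.injective_rightAct_iff.1 h⟩
  · rintro ⟨ha, h⟩
    exact (D a ha).2.injective_rightAct_iff.2 h
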